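/- A \emph{clutter} $\mathcal{C}$ over a finite ground set $V$ is a family of subsets of $V$ (its members), none of which contains another. A \emph{cover} is a subset of $V$ meeting every member; $\tau(\mathcal{C})$ is the minimum cardinality of a cover; the \emph{blocker} $b(\mathcal{C})$ is the clutter over $V$ of the inclusion-wise minimal covers. For disjoint $I,J\subseteq V$, the \emph{minor} $\mathcal{C}\setminus I/J$ is the clutter over $V-(I\cup J)$ consisting of the inclusion-wise minimal sets in $\{C-J: C\in\mathcal{C},\ C\cap I=\emptyset\}$. A \emph{delta} is a clutter over a set $\{a_1,\dots,a_n\}$ of $n\ge 3$ elements with members $\{a_2,\dots,a_n\}$ and $\{a_1,a_i\}$, $i=2,\dots,n$. An \emph{extended odd hole} is a clutter over a set $\{a_1,\dots,a_n\}$ of $n$ elements, $n\geq 5$ odd, whose minimum cardinality members are exactly $\{a_1,a_2\},\dots,\{a_{n-1},a_n\},\{a_n,a_1\}$. A clutter is \emph{clean} if it has no minor that is a delta or the blocker of an extended odd hole; it is \emph{tangled} if $\tau=2$ and every element belongs to a minimum cover. A \emph{fractional packing} of $\mathcal{C}$ is a vector $y\in\mathbb{R}^{\mathcal{C}}_{\geq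 0}$ with $\sum(y_C: v\in C\in\mathcal{C})\le 1$ for all $v\in V$; its \emph{value} is $\sum_{C} y_C$. The \emph{core} of $\mathcal{C}$ is $\mathrm{core}(\mathcal{C})=\{C\in\mathcal{C}: y_C>0$ for some fractional packing $y$ of value two$\}$, a clutter over $V$. The \emph{rank} $r$ of a tangled clutter $\mathcal{C}$ is the number of connected components of the graph with vertex set $V$ whose edges are the minimum covers of $\mathcal{C}$. For $S\subseteq\{0,1\}^r$, $\mathrm{cuboid}(S)$ is the clutter over $\{1,\dots,2r\}$ whose members have the incidence vectors $(p_1,1-p_1,\dots,p_r,1-p_r)$, $p\in S$. A \emph{duplication} of a clutter is obtained by replacing each element by one or more copies of it (so that a member contains either all or none of the copies of an element). A set $S\subseteq\{0,1\}^r$ is a \emph{setcore} of $\mathcal{C}$, written $S=\mathrm{setcore}(\mathcal{C})$, if $\mathrm{core}(\mathcal{C})$ is, up to relabelling its ground set, a duplication of $\mathrm{cuboid}(S)$. A \emph{simplex} is the convex hull of a nonempty finite affinely independent set of points. \textbf{Theorem.} Let $\mathcal{C}$ be a clean tangled clutter of rank $r$. Then $\mathcal{C}$ has a setcore $S\subseteq\{0,1\}^r$,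 and for every setcore $S$ of $\mathcal{C}$, $\mathrm{conv}(S)\subseteq\mathbb{R}^r$ is a simplex if and only if $\mathcal{C}$ has a unique fractional packing of value two (that is, exactly one). -/

import Mathlib

/-- A clutter over the (finite) ground set `V`: a family of subsets of `V`, called members,
none of which contains another one. -/
structure Clutter (V : Type*) where
  members : Finset (Finset V)
  antichain : IsAntichain (· ⊆ ·) (members : Set (Finset V))

namespace Clutter

section Basic

variable {V : Type*}

open Classical in
/-- The clutter of the inclusion-wise minimal sets of a finite family of finite sets. -/
noncomputable def ofMinimal (F : Finset (Finset V)) : Clutter V where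
  members := F.filter (fun A => Minimal (· ∈ F) A)
  antichain := by
    intro A hA B hB hne hAB
    rw [Finset.mem_coe, Finset.mem_filter] at hA hB
    exact hne (Finset.Subset.antisymm hAB (hB.2.le_of_le hA.1 hAB))

/-- A cover is a subset of the ground set that meets every member. -/
def IsCover (C : Clutter V) (B : Finset V) : Prop :=
  ∀ A ∈ C.members, ∃ v ∈ A, v ∈ B

/-- The covering number: the minimum cardinality of a cover (`⊤` if there is no cover, that is,
if the empty set is a member). -/
noncomputable def coveringNumber (C : Clutter V) : ℕ∞ :=
  ⨅ (B : Finset V) (_ : C.IsCover B), (B.card : ℕ∞)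

/-- A minimum cover is a cover whose cardinality is the covering number. -/
def IsMinimumCover (C : Clutter V) (B : Finset V) : Prop :=
  C.IsCover B ∧ (B.card : ℕ∞) = C.coveringNumber

/-- A clutter is tangled if its covering number is two and every element belongs to a minimum
cover. -/
def IsTangled (C : Clutter V) : Prop :=
  C.coveringNumber = 2 ∧ ∀ v : V, ∃ B, C.IsMinimumCover B ∧ v ∈ B

open Classical in
/-- The blocker: the clutter of the inclusion-wise minimal covers. -/
noncomputable def blocker [Fintype V] (C : Clutter V) : Clutter V :=
  ofMinimal (Finset.univ.filter C.IsCover)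

open Classical in
/-- The minor `C ∖ I / J` over the ground set `V - (I ∪ J)`: its members are the inclusion-wise
minimal sets among `A - J`, where `A` is a member with `A ∩ I = ∅`.  (For such an `A`, the trace
of `A` on `V - (I ∪ J)` is `A - J`.) -/
noncomputable def minor (C : Clutter V) (I J : Finset V) :
    Clutter {v : V // v ∉ I ∧ v ∉ J} :=
  ofMinimal ((C.members.filter (fun A => Disjoint A I)).image
    (fun A => A.subtype (fun v => v ∉ I ∧ v ∉ J)))

open Classical in
/-- A delta: at least three elements `a₁, …, aₙ`, and the members are `{a₂, …, aₙ}` and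
`{a₁, aᵢ}` for `i = 2, …, n`. -/
def IsDelta (C : Clutter V) : Prop :=
  3 ≤ Nat.card V ∧ ∃ a : V, ∀ A : Finset V,
    A ∈ C.members ↔ (∀ v, v ∈ A ↔ v ≠ a) ∨ ∃ b, b ≠ a ∧ A = {a, b}

open Classical in
/-- An extended odd hole: the ground set consists of an odd number `n ≥ 5` of elements
`a₁, …, aₙ`, and the members of minimum cardinality are exactly
`{a₁, a₂}, {a₂, a₃}, …, {aₙ₋₁, aₙ}, {aₙ, a₁}`. -/
def IsExtendedOddHole (C : Clutter V) : Prop :=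
  ∃ (n : ℕ) (a : ZMod n ≃ V), 5 ≤ n ∧ Odd n ∧ ∀ A : Finset V,
    (A ∈ C.members ∧ ∀ B ∈ C.members, A.card ≤ B.card) ↔ ∃ i : ZMod n, A = {a i, a (i + 1)}

open Classical in
/-- A clutter is clean if no minor of it is a delta or the blocker of an extended odd hole. -/
def IsClean [Fintype V] (C : Clutter V) : Prop :=
  ∀ I J : Finset V, Disjoint I J →
    ¬ (C.minor I J).IsDelta ∧
    ¬ ∃ D : Clutter {v : V // v ∉ I ∧ v ∉ J}, D.IsExtendedOddHole ∧ C.minor I J = D.blocker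

open Classical in
/-- A fractional packing: a nonnegative weight on the members such that, for every element `v`,
the total weight of the members containing `v` is at most one. -/
def IsFractionalPacking (C : Clutter V) (y : C.members → ℝ) : Prop :=
  (∀ A, 0 ≤ y A) ∧ ∀ v : V, ∑ A : C.members, (if v ∈ A.1 then y A else 0) ≤ 1

/-- `y` is a fractional packing of value two. -/
def IsFractionalPackingTwo (C : Clutter V) (y : C.members → ℝ) : Prop :=
  C.IsFractionalPacking y ∧ ∑ A : C.members, y A = 2

open Classical in
/-- The core: the members that have positive weight in some fractional packing of value two. -/
noncomputable def core (C : Clutter V) : Clutter V where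
  members := C.members.filter (fun A =>
    ∃ (h : A ∈ C.members) (y : C.members → ℝ), C.IsFractionalPackingTwo y ∧ 0 < y ⟨A, h⟩)
  antichain := C.antichain.subset (by
    intro A hA
    exact (Finset.mem_filter.mp hA).1)

open Classical in
/-- The graph over the ground set whose edges are the minimum covers (for a tangled clutter, these
are the covers of cardinality two). -/
def graph (C : Clutter V) : SimpleGraph V where
  Adj u v := u ≠ v ∧ C.IsMinimumCover {u, v}
  symm := ⟨fun u v h => ⟨h.1.symm, by rw [Finset.pair_comm]; exact h.2⟩⟩
  loopless := ⟨fun _ h => h.1 rfl⟩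

/-- The rank: the number of connected components of the graph of minimum covers. -/
noncomputable def rank (C : Clutter V) : ℕ :=
  Nat.card C.graph.ConnectedComponent

end Basic

/-- `D` is a duplication of `C`, up to relabelling of the ground set: `D` arises from `C` by
replacing every element `w` by a nonempty class of mutual duplicates (`w` together with its
copies, here the fibre `f ⁻¹ {w}`), so that the members of `D` are the preimages of the members
of `C`. -/
def IsDuplication {V W : Type*} (D : Clutter V) (C : Clutter W) : Prop :=
  ∃ f : V → W, Function.Surjective f ∧ ∀ A : Finset V,
    A ∈ D.members ↔ ∃ B ∈ C.members, ∀ v, v ∈ A ↔ f v ∈ B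

/-- The cuboid of `S ⊆ {0,1}ⁿ`.  The ground set `[2n]` is written as `Fin n × Bool`, where
`(i, true)` stands for the `(2i-1)`-st and `(i, false)` for the `2i`-th element
(`i = 1, …, n`), so that the incidence vector of the member of a point `p` is
`(p₁, 1 - p₁, …, pₙ, 1 - pₙ)`. -/
def cuboid {n : ℕ} (S : Finset (Fin n → Bool)) : Clutter (Fin n × Bool) where
  members := S.image (fun p => Finset.univ.filter (fun x : Fin n × Bool => p x.1 = x.2))
  antichain := by
    intro A hA B hB hne hAB
    simp only [Finset.coe_image, Set.mem_image] at hA hB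
    obtain ⟨p, -, rfl⟩ := hA
    obtain ⟨q, -, rfl⟩ := hB
    apply hne
    have hpq : p = q := by
      funext i
      have h : ((i, p i) : Fin n × Bool) ∈
          Finset.univ.filter (fun x : Fin n × Bool => q x.1 = x.2) := hAB (by simp)
      exact (Finset.mem_filter.mp h).2.symm
    rw [hpq]

/-- `S ⊆ {0,1}^r`, where `r` is the rank of `C`, is the setcore of `C`: the core of `C` is a
duplication of the cuboid of `S`.  (This determines `S` up to relabelling and twisting
coordinates.) -/
def IsSetcore {V : Type*} (C : Clutter V) (S : Finset (Fin C.rank → Bool)) : Prop :=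
  C.core.IsDuplication (cuboid S)

end Clutter

/-- A 0-1 point, as a point of `ℝⁿ`. -/
def zeroOnePoint {n : ℕ} (p : Fin n → Bool) : Fin n → ℝ :=
  fun i => if p i then 1 else 0

/-- The convex hull in `ℝⁿ` of a set of 0-1 points. -/
def convOfPoints {n : ℕ} (S : Finset (Fin n → Bool)) : Set (Fin n → ℝ) :=
  convexHull ℝ (zeroOnePoint '' (S : Set (Fin n → Bool)))

/-- A set is a simplex if it is the convex hull of the (`d + 1 ≥ 1` many, affinely independent)
vertices of a `d`-dimensional simplex for some `d`. -/
def IsSimplexSet {n : ℕ} (P : Set (Fin n → ℝ)) : Prop :=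
  ∃ (d : ℕ) (s : Affine.Simplex ℝ (Fin n → ℝ) d), P = convexHull ℝ (Set.range s.points)

/-! The hard part is that a clean tangled clutter has a fractional packing of value two. This is
proved for every minor of covering number at least two, by induction on the number of remaining
elements (`exists_isMinorPacking`). Join two elements if together they cover the minor. An isolated
element may be deleted. Any other element lies in a component that is bipartite, because a shortest
odd cycle would give a delta or the blocker of an extended odd hole (`even_of_linked_self`).
Deleting one side of the component and contracting the other keeps the covering number at least two
(`not_cover_side`, resting on `not_cover_of_evenly_linked`). The packings for the two choices of
side average to one that loads each element at most once.

The rest is linear algebra. A core member contains exactly one end of every minimum cover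
(`mem_core_of_adj`), so relative to a fixed core member it is given by one bit per component; this
yields a setcore. Packings of value two become nonnegative weights on `S` with total two and every
coordinate sum one (`sum_coordinate_eq_one`): up to the factor two, convex representations of the
centre of the cube. Affine independence makes the representation unique. Conversely, a unique
packing is positive on the whole core, so a small multiple of an affine dependency could be added to
it. Finally, 0-1 points are extreme in their hull, so the hull is a simplex exactly when the points
are affinely independent. -/

namespace SimpleGraph

/-! ### Walks of prescribed length. -/

variable {V : Type*} {G : SimpleGraph V}

/-- Two vertices are joined by a walk of length `n`. -/
def Linked (G : SimpleGraph V) (n : ℕ) (u v : V) : Prop :=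
  ∃ p : G.Walk u v, p.length = n

theorem Linked.refl (u : V) : G.Linked 0 u u := ⟨Walk.nil, rfl⟩

theorem Linked.symm {n : ℕ} {u v : V} (h : G.Linked n u v) : G.Linked n v u := by
  obtain ⟨p, hp⟩ := h
  exact ⟨p.reverse, by simpa using hp⟩

theorem Linked.trans {m n : ℕ} {u v w : V} (h : G.Linked m u v) (h' : G.Linked n v w) :
    G.Linked (m + n) u w := by
  obtain ⟨p, hp⟩ := h
  obtain ⟨q, hq⟩ := h'
  exact ⟨p.append q, by simp [hp, hq]⟩

theorem Adj.linked {u v : V} (h : G.Adj u v) : G.Linked 1 u v := ⟨h.toWalk, by simp⟩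

theorem linked_one {u v : V} (h : G.Linked 1 u v) : G.Adj u v := by
  obtain ⟨p, hp⟩ := h
  exact Walk.adj_of_length_eq_one hp

theorem linked_of_adj_succ {f : ℕ → V} {n : ℕ} (h : ∀ i < n, G.Adj (f i) (f (i + 1)))
    {i j : ℕ} (hij : i ≤ j) (hj : j ≤ n) : G.Linked (j - i) (f i) (f j) := by
  induction j, hij using Nat.le_induction with
  | base => simpa using Linked.refl (f i)
  | succ j hij ih =>
    have h1 := (ih (by omega)).trans (h j (by omega)).linked
    rwa [show j - i + 1 = j + 1 - i by omega] at h1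

theorem Linked.exists_path {n : ℕ} {u v : V} (h : G.Linked n u v) :
    ∃ f : ℕ → V, f 0 = u ∧ f n = v ∧ ∀ i < n, G.Adj (f i) (f (i + 1)) := by
  obtain ⟨p, rfl⟩ := h
  exact ⟨p.getVert, by simp, by simp, fun i hi => p.adj_getVert_succ hi⟩

end SimpleGraph

namespace Clutter

open SimpleGraph

/-! ### Bipartiteness and sides of components in a clean cover system. -/

section CoverSystem

variable {V : Type*} [DecidableEq V]

/-- The graph over `M` whose edges are the pairs that form a cover together with `I`. -/
def pairGraph (Cov : Finset V → Prop) (I M : Finset V) : SimpleGraph V where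
  Adj u v := u ≠ v ∧ u ∈ M ∧ v ∈ M ∧ Cov (insert u (insert v I))
  symm := ⟨fun u v h => ⟨h.1.symm, h.2.2.1, h.2.1, by rw [Finset.insert_comm]; exact h.2.2.2⟩⟩
  loopless := ⟨fun _ h => h.1 rfl⟩

/-- A family of covers (an up-set) without the configurations that yield a delta minor or the
blocker of an extended odd hole. -/
structure IsCleanCoverSystem (Cov : Finset V → Prop) : Prop where
  mono : ∀ {X Y : Finset V}, X ⊆ Y → Cov X → Cov Y
  no_delta : ∀ (I N : Finset V) (e : V), 2 ≤ N.card → ¬ Cov (insert e I) →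
    (∀ b ∈ N, Cov (insert e (insert b I))) → Cov (I ∪ N) →
    (∀ b ∈ N, ¬ Cov (I ∪ N.erase b)) → False
  no_hole : ∀ (I : Finset V) (n : ℕ) (a : ℕ → V), 5 ≤ n → Odd n →
    (∀ i < n, ¬ Cov (insert (a i) I)) →
    (∀ i j, i < j → j < n → a i ≠ a j ∧
      (Cov (insert (a i) (insert (a j) I)) ↔ j = i + 1 ∨ (i = 0 ∧ j + 1 = n))) → False

variable {Cov : Finset V → Prop} {I M : Finset V}

/-- A shortest odd closed walk has no repeated vertex and no chord, since either would split it into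
two shorter closed walks, one of them odd. Length one is a loop, length three a delta, and greater
length an odd hole. -/
theorem IsCleanCoverSystem.even_of_linked_self (hC : IsCleanCoverSystem Cov)
    (hM : ∀ u ∈ M, ¬ Cov (insert u I)) {n : ℕ} {u : V}
    (h : (pairGraph Cov I M).Linked n u u) : Even n := by
  induction n using Nat.strong_induction_on generalizing u with
  | _ n ih =>
  by_contra hodd
  rw [Nat.not_even_iff_odd] at hodd
  obtain ⟨f, hf0, hfn, hf⟩ := h.exists_path
  have hfM : ∀ i < n, f i ∈ M := fun i hi => (hf i hi).2.1
  have hloop : (pairGraph Cov I M).Linked 0 (f n) (f 0) := by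
    rw [hfn, hf0]; exact Linked.refl u
  have hout : ∀ i j, i < j → j < n →
      (pairGraph Cov I M).Linked (n - j + i) (f j) (f i) := by
    intro i j hij hj
    have h1 := (linked_of_adj_succ hf hj.le le_rfl).trans
      (hloop.trans (linked_of_adj_succ hf (Nat.zero_le i) (by omega)))
    simpa using h1
  have hin : ∀ i j, i < j → j < n →
      (pairGraph Cov I M).Linked (j - i) (f i) (f j) := fun i j hij hj =>
    linked_of_adj_succ hf hij.le hj.le
  have hinj : ∀ i j, i < j → j < n → f i ≠ f j := by
    intro i j hij hj he
    have h1 := hin i j hij hj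
    have h2 := hout i j hij hj
    rw [he] at h1 h2
    have e1 := ih _ (by omega) h1
    have e2 := ih _ (by omega) h2
    have e3 := e1.add e2
    rw [show j - i + (n - j + i) = n by omega] at e3
    exact (Nat.not_even_iff_odd.2 hodd) e3
  have hadj : ∀ i j, i < j → j < n → (pairGraph Cov I M).Adj (f i) (f j) →
      j = i + 1 ∨ (i = 0 ∧ j + 1 = n) := by
    intro i j hij hj ha
    by_contra hne
    push Not at hne
    have h1 := (hin i j hij hj).trans ha.symm.linked
    have h2 := (hout i j hij hj).trans ha.linked
    have e1 := ih _ (by omega) h1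
    have e2 := ih _ (by omega) h2
    have e3 := e1.add e2
    rw [show j - i + 1 + (n - j + i + 1) = n + 2 by omega] at e3
    rcases hodd with ⟨k, hk⟩
    rcases e3 with ⟨l, hl⟩
    omega
  have hlast : ∀ m, m + 1 = n → (pairGraph Cov I M).Adj (f 0) (f m) := by
    intro m hm
    have h1 := hf m (by omega)
    rw [hm, hfn, ← hf0] at h1
    exact h1.symm
  have hn : n = 1 ∨ n = 3 ∨ 5 ≤ n := by
    rcases hodd with ⟨k, hk⟩; omega
  rcases hn with rfl | rfl | hn
  · exact (linked_one h).1 rfl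
  · have a01 := hf 0 (by omega)
    have a12 := hf 1 (by omega)
    have a02 := hlast 2 rfl
    refine hC.no_delta I {f 1, f 2} (f 0) ?_ (hM _ (hfM 0 (by omega))) ?_ ?_ ?_
    · rw [Finset.card_pair a12.1]
    · intro b hb
      rcases Finset.mem_insert.1 hb with rfl | hb
      · exact a01.2.2.2
      · rw [Finset.mem_singleton] at hb
        subst hb
        exact a02.2.2.2
    · refine hC.mono ?_ a12.2.2.2
      intro x; simp
    · intro b hb
      rcases Finset.mem_insert.1 hb with rfl | hb
      · refine fun h => hM _ (hfM 2 (by omega)) (hC.mono ?_ h)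
        intro x; simp; tauto
      · rw [Finset.mem_singleton] at hb
        subst hb
        refine fun h => hM _ (hfM 1 (by omega)) (hC.mono ?_ h)
        intro x; simp; tauto
  · refine hC.no_hole I n f hn hodd (fun i hi => hM _ (hfM i hi)) ?_
    intro i j hij hj
    refine ⟨hinj i j hij hj, fun h => hadj i j hij hj
      ⟨hinj i j hij hj, hfM i (by omega), hfM j hj, h⟩, ?_⟩
    rintro (rfl | ⟨rfl, h⟩)
    · exact (hf i (by omega)).2.2.2
    · exact (hlast j h).2.2.2

/-- Move into `I` a largest `X ⊆ B \ {f, g}` for which `e` still completes no cover. Every element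
of `B \ X` then forms a cover with `e`, and `B \ X` is still minimal, so `e` and `B \ X` form a
delta. -/
theorem IsCleanCoverSystem.not_common_neighbor (hC : IsCleanCoverSystem Cov)
    (hM : ∀ u ∈ M, ¬ Cov (insert u I)) {B : Finset V} {e f g : V}
    (hB : Cov (I ∪ B)) (hmin : ∀ b ∈ B, ¬ Cov (I ∪ B.erase b))
    (hf : f ∈ B) (hg : g ∈ B) (hfg : f ≠ g) (hef : (pairGraph Cov I M).Adj e f)
    (heg : (pairGraph Cov I M).Adj e g) : False := by
  classical
  have hF : (∅ : Finset V) ∈ (B \ {f, g}).powerset.filter (fun X => ¬ Cov (insert e (I ∪ X))) := by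
    simpa using hM e hef.2.1
  obtain ⟨X, hX, hmax⟩ := Finset.exists_max_image _ Finset.card ⟨_, hF⟩
  rw [Finset.mem_filter, Finset.mem_powerset] at hX
  have hsub : ∀ b ∈ X, b ∈ B ∧ b ≠ f ∧ b ≠ g := by
    intro b hb
    simpa using hX.1 hb
  refine hC.no_delta (I ∪ X) (B \ X) e ?_ hX.2 ?_ ?_ ?_
  · rw [← Finset.card_pair hfg]
    refine Finset.card_le_card ?_
    intro b hb
    rcases Finset.mem_insert.1 hb with rfl | hb
    · exact Finset.mem_sdiff.2 ⟨hf, fun h => (hsub _ h).2.1 rfl⟩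
    · rw [Finset.mem_singleton] at hb
      subst hb
      exact Finset.mem_sdiff.2 ⟨hg, fun h => (hsub _ h).2.2 rfl⟩
  · intro b hb
    rw [Finset.mem_sdiff] at hb
    by_cases hbf : b = f
    · subst hbf
      refine hC.mono ?_ hef.2.2.2
      intro x; simp; tauto
    by_cases hbg : b = g
    · subst hbg
      refine hC.mono ?_ heg.2.2.2
      intro x; simp; tauto
    by_contra hcon
    have := hmax (insert b X) (by
      rw [Finset.mem_filter, Finset.mem_powerset]
      refine ⟨?_, by rwa [Finset.union_insert]⟩
      intro x hx
      rcases Finset.mem_insert.1 hx with rfl | hx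
      · simp [hb.1, hbf, hbg]
      · exact hX.1 hx)
    rw [Finset.card_insert_of_notMem hb.2] at this
    omega
  · refine hC.mono ?_ hB
    intro x; simp; tauto
  · intro b hb h
    rw [Finset.mem_sdiff] at hb
    refine hmin b hb.1 (hC.mono ?_ h)
    intro x hx
    simp only [Finset.mem_union, Finset.mem_erase, Finset.mem_sdiff] at hx ⊢
    rcases hx with (hx | hx) | hx
    · exact Or.inl hx
    · exact Or.inr ⟨fun h => hb.2 (h ▸ hx), (hsub x hx).1⟩
    · exact Or.inr ⟨hx.1, hx.2.1⟩

open Classical in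
/-- A cover contained in one side of a component, except for at most one element that is not on
the other side, does not exist. -/
theorem IsCleanCoverSystem.not_cover_of_evenly_linked (hC : IsCleanCoverSystem Cov)
    (hI : ¬ Cov I) (hM : ∀ u ∈ M, ¬ Cov (insert u I)) {B : Finset V} (hBM : B ⊆ M) (w : V)
    (heven : ∀ x ∈ B, ∀ y ∈ B, x ≠ w → y ≠ w →
      ∃ n, Even n ∧ (pairGraph Cov I M).Linked n x y)
    (hodd : ∀ x ∈ B, x ≠ w → ∀ n, (pairGraph Cov I M).Linked n x w → Even n) :
    ¬ Cov (I ∪ B) := by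
  -- A smallest counterexample `B` is a minimal cover modulo `I`. The plan is to move a part `X` of
  -- `B` into `I` so that the rest lies on one side in the new graph, linked along a shortest path
  -- between two elements of `B`.
  induction hk : B.card using Nat.strong_induction_on generalizing I M B w with
  | _ k ih =>
  subst hk
  intro hcov
  have hmin : ∀ b ∈ B, ¬ Cov (I ∪ B.erase b) := by
    intro b hb
    refine ih _ (Finset.card_erase_lt_of_mem hb) hI hM ((Finset.erase_subset _ _).trans hBM) w
      ?_ ?_ rfl
    · intro x hx y hy
      exact heven x (Finset.mem_of_mem_erase hx) y (Finset.mem_of_mem_erase hy)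
    · intro x hx
      exact hodd x (Finset.mem_of_mem_erase hx)
  have hmiss : ∀ (Y : Finset V) (b : V), Y ⊆ B → b ∈ B → b ∉ Y → ¬ Cov (I ∪ Y) := by
    intro Y b hY hb hbY h
    refine hmin b hb (hC.mono (Finset.union_subset_union_right ?_) h)
    intro y hy
    exact Finset.mem_erase.2 ⟨fun h => hbY (h ▸ hy), hY hy⟩
  have hN : ∀ x ∈ B, ∀ y ∈ B, x ≠ y → ∀ n, (pairGraph Cov I M).Linked n x y → Even n := by
    intro x hx y hy hxy n hn
    by_cases hxw : x = w
    · subst hxw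
      exact hodd y hy hxy.symm n hn.symm
    by_cases hyw : y = w
    · subst hyw
      exact hodd x hx hxy n hn
    obtain ⟨m, hm, hl⟩ := heven x hx y hy hxw hyw
    exact (Nat.even_add.1 (hC.even_of_linked_self hM (hn.trans hl.symm))).2 hm
  have htwo : ∃ n, ∃ f ∈ B, ∃ g ∈ B, f ≠ g ∧ (pairGraph Cov I M).Linked n f g := by
    by_cases h2 : 1 < (B.erase w).card
    · obtain ⟨f, hf, g, hg, hfg⟩ := Finset.one_lt_card.1 h2
      rw [Finset.mem_erase] at hf hg
      obtain ⟨n, -, hn⟩ := heven f hf.2 g hg.2 hf.1 hg.1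
      exact ⟨n, f, hf.2, g, hg.2, hfg, hn⟩
    -- Here `B` is empty, a singleton, or a pair `{x, w}`; in the last case `x` and `w` are
    -- adjacent, which is an odd walk.
    · exfalso
      rcases Finset.eq_empty_or_nonempty (B.erase w) with h0 | ⟨x, hx⟩
      · by_cases hw : w ∈ B
        · refine hM w (hBM hw) (hC.mono ?_ hcov)
          rw [← Finset.insert_erase hw, h0]
          intro x; simp
        · rw [Finset.erase_eq_of_notMem hw] at h0
          rw [h0] at hcov
          exact hI (by simpa using hcov)
      · have hx1 : B.erase w = {x} := by
          refine Finset.eq_singleton_iff_unique_mem.2 ⟨hx, fun y hy => ?_⟩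
          by_contra hne
          exact h2 (Finset.one_lt_card.2 ⟨y, hy, x, hx, hne⟩)
        rw [Finset.mem_erase] at hx
        by_cases hw : w ∈ B
        · have hadj : (pairGraph Cov I M).Adj x w := by
            refine ⟨hx.1, hBM hx.2, hBM hw, hC.mono ?_ hcov⟩
            rw [← Finset.insert_erase hw, hx1]
            intro x; simp; tauto
          have := hodd x hx.2 hx.1 1 hadj.linked
          simp at this
        · rw [Finset.erase_eq_of_notMem hw] at hx1
          refine hM x (hBM hx.2) (hC.mono ?_ hcov)
          rw [hx1]
          intro x; simp
  obtain ⟨⟨f, hf, g, hg, hfg, hn⟩, hnmin⟩ := And.intro (Nat.find_spec htwo)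
    (fun m => Nat.find_min' htwo (m := m))
  generalize Nat.find htwo = n at hn hnmin
  have hnmin' : ∀ m, ∀ x ∈ B, ∀ y ∈ B, x ≠ y → (pairGraph Cov I M).Linked m x y → n ≤ m :=
    fun m x hx y hy hxy h => hnmin m ⟨x, hx, y, hy, hxy, h⟩
  have hneven := hN f hf g hg hfg n hn
  obtain ⟨p, hp0, hpn, hp⟩ := hn.exists_path
  have hlink : ∀ i j, i ≤ j → j ≤ n → (pairGraph Cov I M).Linked (j - i) (p i) (p j) :=
    fun i j => linked_of_adj_succ hp
  have hn0 : n ≠ 0 := by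
    rintro rfl
    exact hfg (hp0.symm.trans hpn)
  have hn2 : n ≠ 2 := by
    rintro rfl
    refine hC.not_common_neighbor hM hcov hmin hf hg hfg (e := p 1) ?_ ?_
    · rw [← hp0]; exact (hp 0 (by omega)).symm
    · rw [← hpn]; exact hp 1 (by omega)
  have hn4 : 4 ≤ n := by
    obtain ⟨l, hl⟩ := hneven
    omega
  have hpM : ∀ j ≤ n, p j ∈ M := by
    intro j hj
    rcases hj.lt_or_eq with hj | rfl
    · exact (hp j hj).2.1
    · rw [hpn]; exact hBM hg
  have hfp : ∀ j ≤ n, (pairGraph Cov I M).Linked j f (p j) := by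
    intro j hj
    simpa [hp0] using hlink 0 j (Nat.zero_le _) hj
  have hgp : ∀ j ≤ n, (pairGraph Cov I M).Linked (n - j) (p j) g := by
    intro j hj
    simpa [hpn] using hlink j n hj le_rfl
  -- Otherwise `i` has walks of length `j + 1` to `f` and `n - j + 1` to `g`; for `n ≥ 4` one of
  -- them is shorter than `n`.
  have hnadj : ∀ i ∈ B, i ≠ f → i ≠ g → ∀ j ≤ n, ¬ Cov (insert (p j) (insert i I)) := by
    intro i hi hif hig j hj h
    have hne : p j ≠ i := by
      intro he
      rw [he, Finset.insert_idem] at h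
      exact hM i (hBM hi) h
    have hadj : (pairGraph Cov I M).Adj (p j) i := ⟨hne, hpM j hj, hBM hi, h⟩
    have h1 := hnmin' _ f hf i hi hif.symm ((hfp j hj).trans hadj.linked)
    have h2 := hnmin' _ i hi g hg hig (hadj.symm.linked.trans (hgp j hj))
    omega
  have hrest : ∃ i ∈ B, i ≠ f ∧ i ≠ g := by
    by_contra hcon
    push Not at hcon
    have hadj : (pairGraph Cov I M).Adj f g := by
      refine ⟨hfg, hBM hf, hBM hg, hC.mono ?_ hcov⟩
      intro x hx
      rcases Finset.mem_union.1 hx with hx | hx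
      · simp [hx]
      · by_cases hxf : x = f
        · simp [hxf]
        · simp [hcon x hx hxf]
    have := hnmin' 1 f hf g hg hfg hadj.linked
    omega
  set P : Finset V := (Finset.range (n + 1)).image p with hP
  have hPmem : ∀ u, u ∈ P ↔ ∃ j ≤ n, p j = u := by
    intro u
    simp [hP]
  -- This is the hypothesis `hM` for the system with `I ∪ X` deleted and the path together with `B \
  -- X` kept. A maximal `X` is taken, so that extending it creates the links needed below.
  let Good : Finset V → Prop := fun X => ∀ u ∈ P ∪ (B \ X), ¬ Cov (insert u (I ∪ X))
  have hempty : (∅ : Finset V) ∈ (B \ {f, g}).powerset.filter Good := by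
    simp only [Finset.mem_filter, Finset.empty_mem_powerset, true_and, Good]
    intro u hu
    rw [Finset.union_empty]
    refine hM u ?_
    rcases Finset.mem_union.1 hu with hu | hu
    · obtain ⟨j, hj, rfl⟩ := (hPmem u).1 hu
      exact hpM j hj
    · exact hBM (Finset.mem_sdiff.1 hu).1
  obtain ⟨X, hX, hmax⟩ := Finset.exists_max_image _ Finset.card ⟨_, hempty⟩
  rw [Finset.mem_filter, Finset.mem_powerset] at hX
  obtain ⟨hXsub, hXgood⟩ := hX
  have hXB : ∀ b ∈ X, b ∈ B ∧ b ≠ f ∧ b ≠ g := by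
    intro b hb
    simpa using hXsub hb
  have hfX : f ∉ X := fun h => (hXB f h).2.1 rfl
  have hgX : g ∉ X := fun h => (hXB g h).2.2 rfl
  have hmiss2 : ∀ x ∈ B, x ≠ f → x ≠ g → ∀ Y ⊆ B, f ∉ Y → g ∉ Y → ∀ u ∈ B,
      ¬ Cov (insert u (I ∪ insert x Y)) := by
    intro x hx hxf hxg Y hY hfY hgY u hu
    rw [← Finset.union_insert]
    have hsub : insert u (insert x Y) ⊆ B := by
      intro y hy
      rcases Finset.mem_insert.1 hy with rfl | hy
      · exact hu
      rcases Finset.mem_insert.1 hy with rfl | hy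
      · exact hx
      exact hY hy
    by_cases huf : u = f
    · refine hmiss _ g hsub hg ?_
      simp [huf, hfg.symm, hxg.symm, hgY]
    · refine hmiss _ f hsub hf ?_
      simp [Ne.symm huf, hxf.symm, hfY]
  -- The third element of `B` shows that `X` is nonempty, which makes `B \ X` small enough for the
  -- final use of the induction hypothesis.
  have hXpos : 0 < X.card := by
    obtain ⟨i, hi, hif, hig⟩ := hrest
    have := hmax {i} (by
      rw [Finset.mem_filter, Finset.mem_powerset]
      refine ⟨by simp [hi, hif, hig], ?_⟩
      intro u hu
      rcases Finset.mem_union.1 hu with hu | hu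
      · obtain ⟨j, hj, rfl⟩ := (hPmem u).1 hu
        intro h
        refine hnadj i hi hif hig j hj (hC.mono ?_ h)
        intro x; simp
      · have := hmiss2 i hi hif hig ∅ (Finset.empty_subset _) (by simp) (by simp) u
          (Finset.mem_sdiff.1 hu).1
        simpa using this)
    simpa using this
  have hp' : ∀ i < n, (pairGraph Cov (I ∪ X) (P ∪ (B \ X))).Adj (p i) (p (i + 1)) := by
    intro i hi
    refine ⟨(hp i hi).1, ?_, ?_, hC.mono ?_ (hp i hi).2.2.2⟩
    · exact Finset.mem_union_left _ ((hPmem _).2 ⟨i, hi.le, rfl⟩)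
    · exact Finset.mem_union_left _ ((hPmem _).2 ⟨i + 1, hi, rfl⟩)
    · intro x; simp; tauto
  have hfp' : ∀ j ≤ n, (pairGraph Cov (I ∪ X) (P ∪ (B \ X))).Linked j f (p j) := by
    intro j hj
    simpa [hp0] using linked_of_adj_succ hp' (Nat.zero_le j) hj
  have hconn : ∀ x ∈ B \ X, ∃ m, Even m ∧
      (pairGraph Cov (I ∪ X) (P ∪ (B \ X))).Linked m x f := by
    intro x hx
    have hx' := Finset.mem_sdiff.1 hx
    by_cases hxf : x = f
    · rw [hxf]
      exact ⟨0, by simp, Linked.refl f⟩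
    by_cases hxg : x = g
    · refine ⟨n, hneven, ?_⟩
      rw [hxg, ← hpn]
      exact (hfp' n le_rfl).symm
    have hbad : ¬ Good (insert x X) := by
      intro hgood
      have := hmax (insert x X) (by
        rw [Finset.mem_filter, Finset.mem_powerset]
        refine ⟨?_, hgood⟩
        intro y hy
        rcases Finset.mem_insert.1 hy with rfl | hy
        · simp [hx'.1, hxf, hxg]
        · exact hXsub hy)
      rw [Finset.card_insert_of_notMem hx'.2] at this
      omega
    simp only [Good] at hbad
    push Not at hbad
    -- By maximality `x` completes a cover with some `u`. A `u` in `B` is excluded by minimality, as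
    -- `f` or `g` would be missing, so `u` is a path vertex `p j`.
    obtain ⟨u, hu, hucov⟩ := hbad
    have huB : u ∉ B := fun h => hmiss2 x hx'.1 hxf hxg X (fun b hb => (hXB b hb).1) hfX hgX u h
      hucov
    have huP : u ∈ P := by
      rcases Finset.mem_union.1 hu with hu | hu
      · exact hu
      · exact absurd (Finset.mem_sdiff.1 hu).1 huB
    obtain ⟨j, hj, rfl⟩ := (hPmem u).1 huP
    rcases Nat.even_or_odd j with hje | hjo
    -- For even `j` the vertex `p j` is on the side of `B`. Replacing `f` and `g` by it gives a
    -- smaller counterexample for the original `I` and `M`. If `f = w`, parities are measured from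
    -- `g`, since `n - j` is even too.
    · exfalso
      have hxp : ∀ y ∈ B, y ≠ w → ∃ m, Even m ∧ (pairGraph Cov I M).Linked m y (p j) := by
        intro y hy hyw
        by_cases hfw : f = w
        · obtain ⟨m, hm, hl⟩ := heven y hy g hg hyw (fun h => hfg (hfw.trans h.symm))
          refine ⟨m + (n - j), hm.add ?_, hl.trans (hgp j hj).symm⟩
          exact (Nat.even_sub hj).2 (by simp [hneven, hje])
        · obtain ⟨m, hm, hl⟩ := heven y hy f hf hyw hfw
          exact ⟨m + j, hm.add hje, hl.trans (hfp j hj)⟩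
      have hpw : ∀ m, (pairGraph Cov I M).Linked m (p j) w → Even m := by
        intro m hm
        by_cases hfw : f = w
        · have h1 := hodd g hg (fun h => hfg (hfw.trans h.symm)) _ ((hgp j hj).symm.trans hm)
          have h2 : Even (n - j) := (Nat.even_sub hj).2 (by simp [hneven, hje])
          exact (Nat.even_add.1 h1).1 h2
        · have h1 := hodd f hf hfw _ ((hfp j hj).trans hm)
          exact (Nat.even_add.1 h1).1 hje
      have hmem : ∀ y ∈ insert (p j) (insert x X), y = p j ∨ (y ∈ B ∧ y ≠ f ∧ y ≠ g) := by
        intro y hy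
        rcases Finset.mem_insert.1 hy with rfl | hy
        · exact Or.inl rfl
        rcases Finset.mem_insert.1 hy with rfl | hy
        · exact Or.inr ⟨hx'.1, hxf, hxg⟩
        · exact Or.inr (hXB y hy)
      refine ih _ ?_ hI hM (B := insert (p j) (insert x X)) ?_ w ?_ ?_ rfl ?_
      · have h1 : insert (p j) (insert x X) ⊆ insert (p j) ((B.erase f).erase g) := by
          intro y hy
          rcases hmem y hy with rfl | hy
          · simp
          · simp [hy]
        have h2 := Finset.card_le_card h1
        have h3 := Finset.card_insert_le (p j) ((B.erase f).erase g)
        have h4 := Finset.card_erase_add_one hf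
        have h5 := Finset.card_erase_add_one (Finset.mem_erase.2 ⟨hfg.symm, hg⟩)
        omega
      · intro y hy
        rcases hmem y hy with rfl | hy
        · exact hpM j hj
        · exact hBM hy.1
      · intro y hy z hz hyw hzw
        rcases hmem y hy with rfl | hy <;> rcases hmem z hz with rfl | hz
        · exact ⟨0, by simp, Linked.refl _⟩
        · obtain ⟨m, hm, hl⟩ := hxp z hz.1 hzw
          exact ⟨m, hm, hl.symm⟩
        · exact hxp y hy.1 hyw
        · exact heven y hy.1 z hz.1 hyw hzw
      · intro y hy hyw
        rcases hmem y hy with rfl | hy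
        · exact hpw
        · exact hodd y hy.1 hyw
      · rwa [Finset.union_insert]
    · have hadj : (pairGraph Cov (I ∪ X) (P ∪ (B \ X))).Adj x (p j) := by
        refine ⟨fun h => huB (h ▸ hx'.1), Finset.mem_union_right _ hx,
          Finset.mem_union_left _ huP, hC.mono ?_ hucov⟩
        intro x; simp; tauto
      exact ⟨1 + j, by rw [add_comm]; exact hjo.add_one, hadj.linked.trans (hfp' j hj).symm⟩
  -- In the new system all of `B \ X` is evenly linked to `f`, which takes the role of `w`.
  refine ih (B \ X).card ?_ (I := I ∪ X) (M := P ∪ (B \ X)) ?_ hXgood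
    Finset.subset_union_right f ?_ ?_ rfl ?_
  · rw [Finset.card_sdiff_of_subset (fun b hb => (hXB b hb).1)]
    have := Finset.card_pos.2 ⟨f, hf⟩
    omega
  · exact hmiss X f (fun b hb => (hXB b hb).1) hf hfX
  · intro x hx y hy _ _
    obtain ⟨a, ha, hxa⟩ := hconn x hx
    obtain ⟨b, hb, hyb⟩ := hconn y hy
    exact ⟨a + b, ha.add hb, hxa.trans hyb.symm⟩
  · intro x hx _ m hm
    obtain ⟨a, ha, hxa⟩ := hconn x hx
    exact (Nat.even_add.1 (hC.even_of_linked_self hXgood (hm.trans hxa.symm))).2 ha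
  · refine hC.mono ?_ hcov
    intro x; simp; tauto

/-- Both claims come from `not_cover_of_evenly_linked`. Its exceptional element is the base vertex
`u₀` for the first, and for the second the added element `w`, which by `hW` no odd walk from `U`
reaches. -/
theorem IsCleanCoverSystem.not_cover_side (hC : IsCleanCoverSystem Cov)
    (hI : ¬ Cov I) (hM : ∀ u ∈ M, ¬ Cov (insert u I)) {U W : Finset V} (hU : U ⊆ M) {u₀ : V}
    (hu₀ : ∀ x ∈ U, ∃ n, Even n ∧ (pairGraph Cov I M).Linked n u₀ x)
    (hW : ∀ w ∈ M, ∀ x ∈ U, ∀ n, Odd n → (pairGraph Cov I M).Linked n x w → w ∈ W) :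
    ¬ Cov (I ∪ U) ∧ ∀ w ∈ M \ (U ∪ W), ¬ Cov (insert w (I ∪ U)) := by
  have heven : ∀ x ∈ U, ∀ y ∈ U, ∃ n, Even n ∧ (pairGraph Cov I M).Linked n x y := by
    intro x hx y hy
    obtain ⟨m, hm, hmx⟩ := hu₀ x hx
    obtain ⟨n, hn, hny⟩ := hu₀ y hy
    exact ⟨m + n, hm.add hn, hmx.symm.trans hny⟩
  constructor
  · refine hC.not_cover_of_evenly_linked hI hM hU u₀ (fun x hx y hy _ _ => heven x hx y hy) ?_
    intro x hx _ n hn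
    obtain ⟨m, hm, hmx⟩ := hu₀ x hx
    exact (Nat.even_add.1 (hC.even_of_linked_self hM (hmx.trans hn))).1 hm
  · intro w hw
    rw [Finset.mem_sdiff, Finset.mem_union, not_or] at hw
    rw [← Finset.union_insert]
    refine hC.not_cover_of_evenly_linked hI hM (Finset.insert_subset hw.1 hU) w ?_ ?_
    · intro x hx y hy hxw hyw
      exact heven x (Finset.mem_of_mem_insert_of_ne hx hxw) y
        (Finset.mem_of_mem_insert_of_ne hy hyw)
    · intro x hx hxw n hn
      by_contra hodd
      rw [Nat.not_even_iff_odd] at hodd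
      exact hw.2.2 (hW w hw.1 x (Finset.mem_of_mem_insert_of_ne hx hxw) n hodd hn)

end CoverSystem

/-! ### Existence of a fractional packing of value two. -/

section Packing

variable {V : Type*}

theorem IsCover.mono {C : Clutter V} {X Y : Finset V} (h : X ⊆ Y) (hX : C.IsCover X) :
    C.IsCover Y := fun A hA => (hX A hA).imp fun _ hv => ⟨hv.1, h hv.2⟩

variable [DecidableEq V]

/-- The total weight of the members containing `v`. -/
def load (C : Clutter V) (y : Finset V → ℝ) (v : V) : ℝ :=
  ∑ A ∈ C.members, if v ∈ A then y A else 0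

/-- A fractional packing of value two of the minor obtained by deleting `I` and contracting
everything outside of `I ∪ M`, as a weight function on all the sets. -/
structure IsMinorPacking (C : Clutter V) (I M : Finset V) (y : Finset V → ℝ) : Prop where
  nonneg : ∀ A, 0 ≤ y A
  disjoint : ∀ A, y A ≠ 0 → Disjoint A I
  value : ∑ A ∈ C.members, y A = 2
  load_le : ∀ v ∈ M, C.load y v ≤ 1

variable {C : Clutter V} {I M : Finset V} {y : Finset V → ℝ}

theorem IsMinorPacking.load_le_two (h : C.IsMinorPacking I M y) (v : V) : C.load y v ≤ 2 := by
  rw [← h.value]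
  refine Finset.sum_le_sum fun A _ => ?_
  split_ifs
  · exact le_rfl
  · exact h.nonneg A

theorem IsMinorPacking.load_eq_zero (h : C.IsMinorPacking I M y) {v : V} (hv : v ∈ I) :
    C.load y v = 0 := by
  refine Finset.sum_eq_zero fun A _ => ?_
  split_ifs with hA
  · by_contra hy
    exact Finset.disjoint_left.1 (h.disjoint A hy) hA hv
  · rfl

theorem load_average (y z : Finset V → ℝ) (v : V) :
    C.load (fun A => (y A + z A) / 2) v = (C.load y v + C.load z v) / 2 := by
  simp only [load]
  rw [← Finset.sum_add_distrib, Finset.sum_div]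
  refine Finset.sum_congr rfl fun A _ => ?_
  split_ifs <;> simp

/-- If the cover system of `C` is clean, then every minor of covering number at least two has a
fractional packing of value two. -/
theorem exists_isMinorPacking (hC : IsCleanCoverSystem C.IsCover) (hI : ¬ C.IsCover I)
    (hM : ∀ u ∈ M, ¬ C.IsCover (insert u I)) : ∃ y, C.IsMinorPacking I M y := by
  classical
  induction hk : M.card using Nat.strong_induction_on generalizing I M with
  | _ k ih =>
  subst hk
  rcases M.eq_empty_or_nonempty with rfl | ⟨u₀, hu₀⟩
  -- With no capacities left, a single member disjoint from `I` can carry the whole weight two.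
  · simp only [IsCover] at hI
    push Not at hI
    obtain ⟨A, hA, hAI⟩ := hI
    refine ⟨fun B => if B = A then 2 else 0, fun B => by split_ifs <;> norm_num,
      ?_, by simp [hA], by simp⟩
    intro B hB
    have : B = A := by by_contra hne; simp [hne] at hB
    rw [this]
    exact Finset.disjoint_left.2 hAI
  by_cases hiso : ∃ v, (pairGraph C.IsCover I M).Adj u₀ v
  · obtain ⟨v₀, hv₀⟩ := hiso
    let U := M.filter fun x => ∃ n, Even n ∧ (pairGraph C.IsCover I M).Linked n u₀ x
    let W := M.filter fun x => ∃ n, Odd n ∧ (pairGraph C.IsCover I M).Linked n u₀ x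
    have hUW : ∀ x, x ∈ U → x ∉ W := by
      intro x hU hW
      obtain ⟨m, hm, hmx⟩ := (Finset.mem_filter.1 hU).2
      obtain ⟨n, hn, hnx⟩ := (Finset.mem_filter.1 hW).2
      exact (Nat.not_even_iff_odd.2 hn)
        ((Nat.even_add.1 (hC.even_of_linked_self hM (hmx.trans hnx.symm))).1 hm)
    have h1 := hC.not_cover_side hI hM (U := U) (W := W) (Finset.filter_subset _ _)
      (fun x hx => (Finset.mem_filter.1 hx).2) (by
        intro w hw x hx n hn hxw
        obtain ⟨m, hm, hmx⟩ := (Finset.mem_filter.1 hx).2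
        exact Finset.mem_filter.2 ⟨hw, m + n, hm.add_odd hn, hmx.trans hxw⟩)
    have h2 := hC.not_cover_side hI hM (U := W) (W := U) (u₀ := v₀) (Finset.filter_subset _ _)
      (by
        intro x hx
        obtain ⟨m, hm, hmx⟩ := (Finset.mem_filter.1 hx).2
        exact ⟨1 + m, by rw [add_comm]; exact hm.add_one, hv₀.symm.linked.trans hmx⟩) (by
        intro w hw x hx n hn hxw
        obtain ⟨m, hm, hmx⟩ := (Finset.mem_filter.1 hx).2
        exact Finset.mem_filter.2 ⟨hw, m + n, hm.add_odd hn, hmx.trans hxw⟩)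
    rw [Finset.union_comm W U] at h2
    have hcard : (M \ (U ∪ W)).card < M.card := by
      refine Finset.card_lt_card (Finset.ssubset_iff_of_subset Finset.sdiff_subset |>.2 ?_)
      refine ⟨u₀, hu₀, fun h => (Finset.mem_sdiff.1 h).2 (Finset.mem_union_left _ ?_)⟩
      exact Finset.mem_filter.2 ⟨hu₀, 0, by simp, Linked.refl _⟩
    obtain ⟨y, hy⟩ := ih _ hcard h1.1 h1.2 rfl
    obtain ⟨z, hz⟩ := ih _ hcard h2.1 h2.2 rfl
    refine ⟨fun A => (y A + z A) / 2, fun A => ?_, fun A hA => ?_, ?_, fun v hv => ?_⟩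
    · exact div_nonneg (add_nonneg (hy.nonneg A) (hz.nonneg A)) zero_le_two
    · by_cases hyA : y A = 0
      · have hzA : z A ≠ 0 := by
          intro h; simp [hyA, h] at hA
        exact (hz.disjoint A hzA).mono_right Finset.subset_union_left
      · exact (hy.disjoint A hyA).mono_right Finset.subset_union_left
    · rw [← Finset.sum_div, Finset.sum_add_distrib, hy.value, hz.value]
      norm_num
    -- On `U` and on `W` one packing has load zero and the other at most its total value two, so the
    -- average is at most one.
    · rw [load_average]
      by_cases hvU : v ∈ U
      · have e1 := hy.load_eq_zero (Finset.mem_union_right I hvU)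
        have e2 := hz.load_le_two v
        linarith
      by_cases hvW : v ∈ W
      · have e1 := hz.load_eq_zero (Finset.mem_union_right I hvW)
        have e2 := hy.load_le_two v
        linarith
      have hv' : v ∈ M \ (U ∪ W) := by simp [hv, hvU, hvW]
      have e1 := hy.load_le v hv'
      have e2 := hz.load_le v hv'
      linarith
  -- An isolated `u₀` is deleted: no other element of `M` completes a cover with it, so the
  -- induction hypothesis applies to `insert u₀ I`.
  · push Not at hiso
    obtain ⟨y, hy⟩ := ih _ (Finset.card_erase_lt_of_mem hu₀) (hM u₀ hu₀) (M := M.erase u₀) (by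
      intro v hv h
      rw [Finset.mem_erase] at hv
      exact hiso v ⟨hv.1.symm, hu₀, hv.2, by rwa [Finset.insert_comm]⟩) rfl
    refine ⟨y, hy.nonneg, fun A hA => (hy.disjoint A hA).mono_right (Finset.subset_insert _ _),
      hy.value, fun v hv => ?_⟩
    by_cases hvu : v = u₀
    · rw [hvu, hy.load_eq_zero (Finset.mem_insert_self _ _)]
      exact zero_le_one
    · exact hy.load_le v (Finset.mem_erase.2 ⟨hvu, hv⟩)

end Packing

end Clutter

namespace Clutter

/-! ### Clean clutters have clean cover systems. -/

section Minor

variable {V : Type*}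

theorem exists_mem_ofMinimal_subset {F : Finset (Finset V)} {A : Finset V} (hA : A ∈ F) :
    ∃ B ∈ (ofMinimal F).members, B ⊆ A := by
  classical
  obtain ⟨B, hBA, hB⟩ := exists_minimal_le_of_wellFoundedLT (· ∈ F) A hA
  exact ⟨B, by simpa [ofMinimal] using ⟨hB.prop, hB⟩, hBA⟩

theorem isCover_ofMinimal {F : Finset (Finset V)} {X : Finset V} :
    (ofMinimal F).IsCover X ↔ ∀ A ∈ F, ∃ v ∈ A, v ∈ X := by
  classical
  constructor
  · intro h A hA
    obtain ⟨B, hB, hBA⟩ := exists_mem_ofMinimal_subset hA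
    exact (h B hB).imp fun v hv => ⟨hBA hv.1, hv.2⟩
  · intro h A hA
    exact h A (Finset.mem_filter.1 hA).1

/-- Deleting `I` amounts to giving `I` to every cover for free; contracting `J` only forbids covers
to use `J`. -/
theorem isCover_minor [DecidableEq V] {C : Clutter V} {I J : Finset V}
    {X : Finset {v : V // v ∉ I ∧ v ∉ J}} :
    (C.minor I J).IsCover X ↔ C.IsCover (I ∪ X.map (Function.Embedding.subtype _)) := by
  classical
  rw [minor, isCover_ofMinimal]
  simp only [Finset.mem_image, Finset.mem_filter, forall_exists_index, and_imp]
  constructor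
  · intro h A hA
    by_cases hd : Disjoint A I
    · obtain ⟨v, hv, hvX⟩ := h _ A hA hd rfl
      refine ⟨v, by simpa using hv, Finset.mem_union_right _ ?_⟩
      exact Finset.mem_map.2 ⟨v, hvX, rfl⟩
    · obtain ⟨v, hv, hvI⟩ := Finset.not_disjoint_iff.1 hd
      exact ⟨v, hv, Finset.mem_union_left _ hvI⟩
  · rintro h _ A hA hd rfl
    obtain ⟨v, hv, hvX⟩ := h A hA
    rcases Finset.mem_union.1 hvX with hvI | hvX
    · exact absurd hvI (Finset.disjoint_left.1 hd hv)
    · obtain ⟨w, hw, rfl⟩ := Finset.mem_map.1 hvX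
      exact ⟨w, by simpa using hv, hw⟩

theorem eq_of_mem_of_subset {D : Clutter V} {A B : Finset V} (hA : A ∈ D.members)
    (hB : B ∈ D.members) (h : A ⊆ B) : A = B := D.antichain.eq hA hB h

theorem ext_members {D E : Clutter V} (h : D.members = E.members) : D = E := by
  cases D; cases E; congr

variable [Fintype V]

theorem exists_mem_subset_of_not_isCover [DecidableEq V] {D : Clutter V} {X : Finset V}
    (h : ¬ D.IsCover X) : ∃ A ∈ D.members, A ⊆ Xᶜ := by
  simp only [IsCover] at h
  push Not at h
  obtain ⟨A, hA, hAX⟩ := h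
  exact ⟨A, hA, fun v hv => Finset.mem_compl.2 (hAX v hv)⟩

theorem isCover_blocker {D : Clutter V} {T : Finset V} :
    D.blocker.IsCover T ↔ ∃ A ∈ D.members, A ⊆ T := by
  classical
  rw [blocker, isCover_ofMinimal]
  simp only [Finset.mem_filter, Finset.mem_univ, true_and]
  constructor
  · intro h
    by_contra hcon
    have hcov : D.IsCover Tᶜ := by
      by_contra hc
      obtain ⟨A, hA, hAT⟩ := exists_mem_subset_of_not_isCover hc
      exact hcon ⟨A, hA, by simpa using hAT⟩
    obtain ⟨v, hv, hvT⟩ := h _ hcov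
    exact Finset.mem_compl.1 hv hvT
  · rintro ⟨A, hA, hAT⟩ X hX
    obtain ⟨v, hv, hvX⟩ := hX A hA
    exact ⟨v, hvX, hAT hv⟩

theorem blocker_blocker (D : Clutter V) : D.blocker.blocker = D := by
  classical
  refine ext_members (Finset.ext fun A => ?_)
  have h : A ∈ D.blocker.blocker.members ↔ Minimal (fun T => ∃ B ∈ D.members, B ⊆ T) A := by
    rw [blocker, ofMinimal]
    simp only [Finset.mem_filter, Finset.mem_univ, true_and, isCover_blocker]
    exact ⟨fun h => h.2, fun h => ⟨h.prop, h⟩⟩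
  rw [h]
  constructor
  · rintro ⟨⟨B, hB, hBA⟩, hmin⟩
    have : A ≤ B := hmin ⟨B, hB, subset_rfl⟩ hBA
    rwa [Finset.Subset.antisymm this hBA]
  · intro hA
    refine ⟨⟨A, hA, subset_rfl⟩, ?_⟩
    rintro T ⟨B, hB, hBT⟩ hTA
    rw [← eq_of_mem_of_subset hB hA (hBT.trans hTA)]
    exact hBT

-- A delta is its own blocker, so it can be recognised from its covers: the non-covers supply
-- members of the required shape, and the covers force them to be no smaller.
open Classical in
theorem isDelta_of_isCover {D : Clutter V} {a : V} (hcard : 3 ≤ Nat.card V)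
    (hpair : ∀ b, b ≠ a → D.IsCover {a, b}) (ha : ¬ D.IsCover {a})
    (hcompl : D.IsCover (Finset.univ.erase a))
    (hmin : ∀ b, b ≠ a → ¬ D.IsCover ((Finset.univ.erase a).erase b)) : D.IsDelta := by
  have hmem : ∀ A ∈ D.members, a ∉ A → ∀ b, b ≠ a → b ∈ A := by
    intro A hA haA b hb
    obtain ⟨v, hv, hvb⟩ := hpair b hb A hA
    rcases Finset.mem_insert.1 hvb with rfl | hvb
    · exact absurd hv haA
    · rwa [← Finset.mem_singleton.1 hvb]
  have hsub : ∀ b, b ≠ a → ∃ A ∈ D.members, A ⊆ {a, b} := by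
    intro b hb
    obtain ⟨A, hA, hAs⟩ := exists_mem_subset_of_not_isCover (hmin b hb)
    refine ⟨A, hA, fun v hv => ?_⟩
    have := hAs hv
    simp at this ⊢
    tauto
  refine ⟨hcard, a, fun A => ⟨fun hA => ?_, ?_⟩⟩
  · by_cases haA : a ∈ A
    · right
      obtain ⟨b, hb, hba⟩ := hcompl A hA
      rw [Finset.mem_erase] at hba
      obtain ⟨A', hA', hs⟩ := hsub b hba.1
      have hAA : A' = A := by
        refine eq_of_mem_of_subset hA' hA (hs.trans ?_)
        intro v hv
        rcases Finset.mem_insert.1 hv with rfl | hv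
        · exact haA
        · rwa [Finset.mem_singleton.1 hv]
      refine ⟨b, hba.1, ?_⟩
      rw [hAA] at hs
      refine Finset.Subset.antisymm hs ?_
      intro v hv
      rcases Finset.mem_insert.1 hv with rfl | hv
      · exact haA
      · rwa [Finset.mem_singleton.1 hv]
    · left
      intro v
      exact ⟨fun hv h => haA (h ▸ hv), hmem A hA haA v⟩
  · rintro (hA | ⟨b, hb, rfl⟩)
    · obtain ⟨A', hA', hs⟩ := exists_mem_subset_of_not_isCover ha
      have haA' : a ∉ A' := fun h => by simpa using hs h
      have : A' = A := by
        ext v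
        rw [hA]
        exact ⟨fun hv h => haA' (h ▸ hv), hmem A' hA' haA' v⟩
      rwa [← this]
    · obtain ⟨A', hA', hs⟩ := hsub b hb
      have haA' : a ∈ A' := by
        -- A member avoiding `a` contains everything else, which fits into `{a, b}` only if there
        -- are at most two elements.
        by_contra haA'
        have h1 : (Finset.univ : Finset V) ⊆ {a, b} := by
          intro v _
          by_cases hva : v = a
          · simp [hva]
          · exact hs (hmem A' hA' haA' v hva)
        have h2 := Finset.card_le_card h1
        rw [Finset.card_univ, ← Nat.card_eq_fintype_card] at h2
        have h3 := Finset.card_le_two (a := a) (b := b)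
        omega
      have hbA' : b ∈ A' := by
        obtain ⟨v, hv, hva⟩ := hcompl A' hA'
        have h1 := hs hv
        rw [Finset.mem_erase] at hva
        simp only [Finset.mem_insert, Finset.mem_singleton] at h1
        rcases h1 with h1 | h1
        · exact absurd h1 hva.1
        · rwa [← h1]
      have : A' = {a, b} := by
        refine Finset.Subset.antisymm hs ?_
        intro v hv
        rcases Finset.mem_insert.1 hv with rfl | hv
        · exact haA'
        · rwa [Finset.mem_singleton.1 hv]
      rwa [← this]

-- No cover has fewer than two elements, so the covers of size two are exactly the minimum members
-- of the blocker.
open Classical in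
theorem isExtendedOddHole_blocker {D : Clutter V} {n : ℕ} (a : ZMod n ≃ V)
    (hn : 5 ≤ n) (hodd : Odd n) (hsingle : ∀ i, ¬ D.IsCover {a i})
    (hpair : ∀ i j, i ≠ j → (D.IsCover {a i, a j} ↔ j = i + 1 ∨ i = j + 1)) :
    D.blocker.IsExtendedOddHole := by
  have : Fact (1 < n) := ⟨by omega⟩
  have hne : ∀ i : ZMod n, i ≠ i + 1 := by simp
  have hcov : ∀ X, D.IsCover X → 2 ≤ X.card := by
    intro X hX
    by_contra hlt
    have : Nonempty V := ⟨a 0⟩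
    obtain ⟨x, hx⟩ := Finset.card_le_one_iff_subset_singleton (s := X).1 (by omega)
    refine hsingle (a.symm x) ?_
    simpa using hX.mono hx
  have hmem : ∀ A, A ∈ D.blocker.members ↔ Minimal D.IsCover A := by
    intro A
    simp only [blocker, ofMinimal, Finset.mem_filter, Finset.mem_univ, true_and]
    exact ⟨fun h => h.2, fun h => ⟨h.prop, h⟩⟩
  have hmem' : ∀ i, ({a i, a (i + 1)} : Finset V) ∈ D.blocker.members ∧
      ({a i, a (i + 1)} : Finset V).card = 2 := by
    intro i
    have hc : ({a i, a (i + 1)} : Finset V).card = 2 :=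
      Finset.card_pair (fun h => hne i (a.injective h))
    refine ⟨(hmem _).2 ⟨(hpair i (i + 1) (hne i)).2 (Or.inl rfl), ?_⟩, hc⟩
    intro X hX hXs
    refine (Finset.eq_of_subset_of_card_le hXs ?_).ge
    rw [hc]
    exact hcov X hX
  refine ⟨n, a, hn, hodd, fun A => ⟨?_, ?_⟩⟩
  · rintro ⟨hA, hmin⟩
    have h1 := hmin _ (hmem' 0).1
    rw [(hmem' 0).2] at h1
    have hAc := ((hmem A).1 hA).prop
    have h2 := hcov A hAc
    obtain ⟨x, y, hxy, rfl⟩ := Finset.card_eq_two.1 (le_antisymm h1 h2)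
    obtain ⟨i, rfl⟩ := a.surjective x
    obtain ⟨j, rfl⟩ := a.surjective y
    rcases (hpair i j (fun h => hxy (by rw [h]))).1 hAc with rfl | rfl
    · exact ⟨i, rfl⟩
    · exact ⟨j, by rw [Finset.pair_comm]⟩
  · rintro ⟨i, hi⟩
    rw [hi]
    refine ⟨(hmem' i).1, fun B hB => ?_⟩
    rw [(hmem' i).2]
    exact hcov B ((hmem B).1 hB).prop

/-- Delete `I` and contract everything outside `I`, `N` and `e`. The hypotheses force these three to
be disjoint, and the minor is a delta. -/
theorem IsClean.no_delta [DecidableEq V] {C : Clutter V} (hC : C.IsClean) (I N : Finset V) (e : V)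
    (hN : 2 ≤ N.card) (he : ¬ C.IsCover (insert e I))
    (hpair : ∀ b ∈ N, C.IsCover (insert e (insert b I))) (hcov : C.IsCover (I ∪ N))
    (hmin : ∀ b ∈ N, ¬ C.IsCover (I ∪ N.erase b)) : False := by
  classical
  have heN : e ∉ N := fun h => he (by simpa using hpair e h)
  have hNI : ∀ b ∈ N, b ∉ I := by
    intro b hb hbI
    have := hpair b hb
    rw [Finset.insert_eq_of_mem hbI] at this
    exact he this
  have heI : e ∉ I := by
    intro heI
    obtain ⟨b, hb, c, hc, hbc⟩ := Finset.one_lt_card.1 hN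
    refine hmin b hb ((hpair c hc).mono ?_)
    intro x hx
    simp only [Finset.mem_insert] at hx
    rcases hx with rfl | rfl | hx
    · simp [heI]
    · simp [hc, hbc.symm]
    · simp [hx]
  set J : Finset V := (I ∪ insert e N)ᶜ with hJ
  have hW : ∀ v, (v ∉ I ∧ v ∉ J) ↔ v = e ∨ v ∈ N := by
    intro v
    simp only [hJ, Finset.mem_compl, Finset.mem_union, Finset.mem_insert, not_not]
    constructor
    · tauto
    · rintro (rfl | h)
      · exact ⟨heI, by tauto⟩
      · exact ⟨hNI v h, by tauto⟩
  refine (hC I J ?_).1 (isDelta_of_isCover (a := ⟨e, (hW e).2 (Or.inl rfl)⟩) ?_ ?_ ?_ ?_ ?_)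
  · exact Finset.disjoint_left.2 fun v hv => by simp [hJ, hv]
  · rw [Nat.card_eq_fintype_card, Fintype.card_subtype]
    have : Finset.univ.filter (fun v => v ∉ I ∧ v ∉ J) = insert e N := by
      ext v; simp [hW]
    rw [this, Finset.card_insert_of_notMem heN]
    omega
  · rintro ⟨b, hb⟩ hbe
    have hbN : b ∈ N := ((hW b).1 hb).resolve_left fun h => hbe (by simp [h])
    rw [isCover_minor]
    refine (hpair b hbN).mono ?_
    intro x; simp
  · rw [isCover_minor]
    refine fun h => he (h.mono ?_)
    intro x; simp
  · rw [isCover_minor]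
    refine hcov.mono ?_
    intro x hx
    rcases Finset.mem_union.1 hx with hx | hx
    · simp [hx]
    · refine Finset.mem_union_right _ (Finset.mem_map.2 ⟨⟨x, (hW x).2 (Or.inr hx)⟩, ?_, rfl⟩)
      simp only [Finset.mem_erase, Finset.mem_univ, and_true, ne_eq, Subtype.mk.injEq]
      rintro rfl
      exact heN hx
  · rintro ⟨b, hb⟩ hbe
    have hbN : b ∈ N := ((hW b).1 hb).resolve_left fun h => hbe (by simp [h])
    rw [isCover_minor]
    refine fun h => hmin b hbN (h.mono ?_)
    intro x hx
    rcases Finset.mem_union.1 hx with hx | hx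
    · simp [hx]
    · obtain ⟨⟨y, hy⟩, hyb, rfl⟩ := Finset.mem_map.1 hx
      simp only [Finset.mem_erase, Finset.mem_univ, and_true, ne_eq, Subtype.mk.injEq] at hyb
      refine Finset.mem_union_right _ (Finset.mem_erase.2 ⟨hyb.1, ?_⟩)
      exact ((hW y).1 hy).resolve_left hyb.2

/-- Delete `I` and contract everything off the cycle. The blocker of this minor is an extended odd
hole, and the minor is the blocker of that blocker. -/
theorem IsClean.no_hole [DecidableEq V] {C : Clutter V} (hC : C.IsClean) (I : Finset V) (n : ℕ)
    (a : ℕ → V) (hn : 5 ≤ n) (hodd : Odd n) (hsingle : ∀ i < n, ¬ C.IsCover (insert (a i) I))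
    (hpair : ∀ i j, i < j → j < n → a i ≠ a j ∧
      (C.IsCover (insert (a i) (insert (a j) I)) ↔ j = i + 1 ∨ (i = 0 ∧ j + 1 = n))) : False := by
  classical
  have hF : Fact (1 < n) := ⟨by omega⟩
  have haI : ∀ i < n, a i ∉ I := by
    intro i hi hiI
    by_cases h : i + 1 < n
    · have h1 := (hpair i (i + 1) (by omega) h).2.2 (Or.inl rfl)
      rw [Finset.insert_comm, Finset.insert_eq_of_mem hiI] at h1
      exact hsingle (i + 1) h h1
    · have h1 := (hpair 0 i (by omega) hi).2.2 (Or.inr ⟨rfl, by omega⟩)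
      rw [Finset.insert_eq_of_mem hiI] at h1
      exact hsingle 0 (by omega) h1
  set J : Finset V := (I ∪ (Finset.range n).image a)ᶜ with hJ
  have hW : ∀ v, (v ∉ I ∧ v ∉ J) ↔ ∃ i < n, a i = v := by
    intro v
    simp only [hJ, Finset.mem_compl, Finset.mem_union, Finset.mem_image, Finset.mem_range,
      not_not]
    constructor
    · tauto
    · rintro ⟨i, hi, rfl⟩
      exact ⟨haI i hi, Or.inr ⟨i, hi, rfl⟩⟩
  have hbij : Function.Bijective (fun i : ZMod n =>
      (⟨a i.val, (hW _).2 ⟨_, i.val_lt, rfl⟩⟩ : {v : V // v ∉ I ∧ v ∉ J})) := by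
    constructor
    · intro i j hij
      simp only [Subtype.mk.injEq] at hij
      rcases lt_trichotomy i.val j.val with h | h | h
      · exact absurd hij (hpair _ _ h j.val_lt).1
      · exact ZMod.val_injective n h
      · exact absurd hij.symm (hpair _ _ h i.val_lt).1
    · rintro ⟨v, hv⟩
      obtain ⟨i, hi, rfl⟩ := (hW v).1 hv
      exact ⟨(i : ZMod n), by simp [ZMod.val_natCast_of_lt hi]⟩
  obtain ⟨b, hb⟩ : ∃ b : ZMod n ≃ {v : V // v ∉ I ∧ v ∉ J}, ∀ i, (b i : V) = a i.val :=
    ⟨Equiv.ofBijective _ hbij, fun i => rfl⟩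
  have hsucc : ∀ i j : ZMod n, j = i + 1 ↔
      j.val = i.val + 1 ∨ (j.val = 0 ∧ i.val + 1 = n) := by
    intro i j
    have hi := i.val_lt
    rw [← (ZMod.val_injective n).eq_iff, ZMod.val_add, ZMod.val_one]
    by_cases h : i.val + 1 = n
    · have := j.val_lt
      rw [h, Nat.mod_self]
      omega
    · rw [Nat.mod_eq_of_lt (by omega)]
      omega
  have key : ∀ i j : ZMod n, i.val < j.val →
      (C.IsCover (insert (a i.val) (insert (a j.val) I)) ↔ j = i + 1 ∨ i = j + 1) := by
    intro i j hij
    have := i.val_lt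
    have := j.val_lt
    rw [(hpair _ _ hij j.val_lt).2, hsucc, hsucc]
    omega
  refine (hC I J ?_).2 ⟨(C.minor I J).blocker, isExtendedOddHole_blocker b hn hodd ?_ ?_, ?_⟩
  · exact Finset.disjoint_left.2 fun v hv => by simp [hJ, hv]
  · intro i
    rw [isCover_minor]
    refine fun h => hsingle i.val i.val_lt (h.mono ?_)
    rw [Finset.map_singleton, Function.Embedding.subtype_apply, hb, Finset.union_comm,
      Finset.insert_eq]
  · intro i j hij
    have hset : ∀ X : Finset {v : V // v ∉ I ∧ v ∉ J}, (∀ x, x ∈ X ↔ x = b i ∨ x = b j) →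
        I ∪ X.map (Function.Embedding.subtype _) = insert (a i.val) (insert (a j.val) I) := by
      intro X hX
      have : X = {b i, b j} := by ext x; simp [hX]
      rw [this, Finset.map_insert, Finset.map_singleton, Function.Embedding.subtype_apply,
        Function.Embedding.subtype_apply, hb, hb, Finset.union_insert, Finset.union_comm,
        ← Finset.insert_eq (a j.val)]
    rw [isCover_minor, hset _ (fun x => by simp)]
    rcases lt_trichotomy i.val j.val with h | h | h
    · exact key i j h
    · exact absurd (ZMod.val_injective n h) hij
    · rw [Finset.insert_comm, key j i h, or_comm]
  · convert (blocker_blocker _).symm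

theorem IsClean.isCleanCoverSystem [DecidableEq V] {C : Clutter V} (hC : C.IsClean) :
    IsCleanCoverSystem C.IsCover where
  mono := fun h hX => hX.mono h
  no_delta := hC.no_delta
  no_hole := hC.no_hole

end Minor

end Clutter

/-! ### Simplices spanned by 0-1 points. -/

section Simplex

variable {n : ℕ}

theorem zeroOnePoint_injective : Function.Injective (zeroOnePoint (n := n)) := by
  intro p q h
  funext i
  have := congrFun h i
  simp only [zeroOnePoint] at this
  cases hp : p i <;> cases hq : q i <;> simp [hp, hq] at this ⊢

theorem convOfPoints_subset (S : Finset (Fin n → Bool)) : convOfPoints S ⊆ Set.Icc 0 1 := by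
  refine convexHull_min ?_ (convex_Icc 0 1)
  rintro _ ⟨p, -, rfl⟩
  constructor <;> intro i <;> simp only [zeroOnePoint, Pi.zero_apply, Pi.one_apply] <;>
    split_ifs <;> norm_num

/-- The hull lies in the unit cube, where a coordinate equal to 0 or 1 inside an open segment has
that value at both ends. -/
theorem zeroOnePoint_mem_extremePoints {S : Finset (Fin n → Bool)} {p : Fin n → Bool}
    (hp : p ∈ S) : zeroOnePoint p ∈ (convOfPoints S).extremePoints ℝ := by
  refine mem_extremePoints_iff_left.2 ⟨subset_convexHull ℝ _ ⟨p, hp, rfl⟩, ?_⟩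
  rintro x hx y hy ⟨a, b, ha, hb, hab, hxy⟩
  have hx := convOfPoints_subset S hx
  have hy := convOfPoints_subset S hy
  funext i
  have hi : a * x i + b * y i = zeroOnePoint p i := by simpa using congrFun hxy i
  have hx0 : 0 ≤ x i := hx.1 i
  have hx1 : x i ≤ 1 := hx.2 i
  have hy0 : 0 ≤ y i := hy.1 i
  have hy1 : y i ≤ 1 := hy.2 i
  simp only [zeroOnePoint] at hi ⊢
  split_ifs at hi ⊢ <;> nlinarith

theorem affineIndependent_zeroOnePoint_iff {S : Finset (Fin n → Bool)} :
    AffineIndependent ℝ (fun p : S => zeroOnePoint p.1) ↔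
      ∀ μ : (Fin n → Bool) → ℝ, ∑ p ∈ S, μ p = 0 →
        (∀ i, ∑ p ∈ S, (if p i then μ p else 0) = 0) → ∀ p ∈ S, μ p = 0 := by
  classical
  have hcoord : ∀ (μ : (Fin n → Bool) → ℝ) (i : Fin n) (T : Finset (Fin n → Bool)),
      (∑ p ∈ T, μ p • zeroOnePoint p) i = ∑ p ∈ T, (if p i then μ p else 0) := by
    intro μ i T
    simp [Finset.sum_apply, zeroOnePoint]
  rw [affineIndependent_iff]
  constructor
  · intro h μ h0 h1 p hp
    refine h Finset.univ (fun p => μ p.1) ?_ ?_ ⟨p, hp⟩ (Finset.mem_univ _)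
    · rw [← h0]; exact Finset.sum_coe_sort S μ
    · rw [Finset.sum_coe_sort S (fun p => μ p • zeroOnePoint p)]
      funext i
      rw [hcoord, h1]; rfl
  · intro h s w h0 h1 p hp
    let μ : (Fin n → Bool) → ℝ := fun p => if hp : p ∈ S then (if (⟨p, hp⟩ : S) ∈ s then w ⟨p, hp⟩
      else 0) else 0
    have hμ : ∀ p : S, μ p.1 = if p ∈ s then w p else 0 := by
      intro p
      simp [μ]
    have := h μ ?_ ?_ p.1 p.2
    · rwa [hμ, if_pos hp] at this
    · rw [← Finset.sum_coe_sort S μ, ← h0]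
      simp only [hμ, Finset.sum_ite_mem, Finset.univ_inter]
    · intro i
      rw [← hcoord, ← Finset.sum_coe_sort S (fun p => μ p • zeroOnePoint p)]
      simp only [hμ, ite_smul, zero_smul, Finset.sum_ite_mem, Finset.univ_inter]
      rw [h1]; rfl

/-- The points of `S` are extreme in the hull, hence are among the vertices of any simplex equal to
it and inherit affine independence. -/
theorem isSimplexSet_convOfPoints_iff {S : Finset (Fin n → Bool)} (hS : S.Nonempty) :
    IsSimplexSet (convOfPoints S) ↔ AffineIndependent ℝ (fun p : S => zeroOnePoint p.1) := by
  constructor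
  · rintro ⟨d, s, hs⟩
    have hsub : ∀ p : S, zeroOnePoint p.1 ∈ Set.range s.points := by
      intro p
      have h := zeroOnePoint_mem_extremePoints p.2
      rw [hs] at h
      exact extremePoints_convexHull_subset h
    exact s.independent.range.comp_embedding
      ⟨fun p : S => ⟨zeroOnePoint p.1, hsub p⟩, fun p q h =>
        Subtype.ext (zeroOnePoint_injective (Subtype.mk.inj h))⟩
  · intro h
    have hcard : Fintype.card S = (S.card - 1) + 1 := by
      have := Finset.card_pos.2 hS
      rw [Fintype.card_coe]; omega
    let e := (Fintype.equivFinOfCardEq hcard).symm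
    refine ⟨S.card - 1, ⟨fun i => zeroOnePoint (e i).1, h.comp_embedding e.toEmbedding⟩, ?_⟩
    rw [convOfPoints]
    congr 1
    ext x
    constructor
    · rintro ⟨p, hp, rfl⟩
      exact ⟨e.symm ⟨p, hp⟩, by simp⟩
    · rintro ⟨i, rfl⟩
      exact ⟨(e i).1, (e i).2, rfl⟩

end Simplex

namespace Clutter

open SimpleGraph

/-! ### Minimum covers of a tangled clutter. -/

section Tangled

variable {V : Type*} {C : Clutter V}

theorem IsTangled.two_le_card (hC : C.IsTangled) {B : Finset V} (hB : C.IsCover B) :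
    2 ≤ B.card := by
  have h : C.coveringNumber ≤ (B.card : ℕ∞) := iInf₂_le B hB
  rw [hC.1] at h
  exact_mod_cast h

open Classical in
theorem IsTangled.exists_adj (hC : C.IsTangled) (v : V) : ∃ u, C.graph.Adj v u := by
  obtain ⟨B, hB, hv⟩ := hC.2 v
  have hcard : B.card = 2 := by
    have h := hB.2
    rw [hC.1] at h
    exact_mod_cast h
  obtain ⟨x, y, hxy, rfl⟩ := Finset.card_eq_two.1 hcard
  rcases Finset.mem_insert.1 hv with rfl | hv
  · exact ⟨y, hxy, hB⟩
  · rw [Finset.mem_singleton] at hv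
    subst hv
    exact ⟨x, hxy.symm, by rwa [Finset.pair_comm]⟩

open Classical in
theorem mem_or_mem_of_adj {u v : V} (h : C.graph.Adj u v) {A : Finset V} (hA : A ∈ C.members) :
    u ∈ A ∨ v ∈ A := by
  obtain ⟨x, hx, hxu⟩ := h.2.1 A hA
  simp only [Finset.mem_insert, Finset.mem_singleton] at hxu
  rcases hxu with rfl | rfl
  · exact Or.inl hx
  · exact Or.inr hx

end Tangled

/-! ### The core and the existence of a setcore. -/

section Core

variable {V : Type*} {C : Clutter V}

/-- The weight of a member, extended by zero to all the sets. -/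
noncomputable def extendWeight (y : C.members → ℝ) : Finset V → ℝ :=
  Function.extend Subtype.val y 0

theorem extendWeight_coe (y : C.members → ℝ) (A : C.members) : extendWeight y A.1 = y A :=
  Subtype.val_injective.extend_apply y 0 A

theorem eq_extendWeight (y : C.members → ℝ) : y = fun A => extendWeight y A.1 :=
  funext fun A => (extendWeight_coe y A).symm

theorem mem_core_iff {A : Finset V} : A ∈ C.core.members ↔ A ∈ C.members ∧
    ∃ Y : Finset V → ℝ, C.IsFractionalPackingTwo (fun A => Y A.1) ∧ 0 < Y A := by
  classical
  simp only [core, Finset.mem_filter]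
  constructor
  · rintro ⟨hA, _, y, hy, hpos⟩
    refine ⟨hA, extendWeight y, by rwa [← eq_extendWeight], ?_⟩
    rwa [extendWeight_coe y ⟨A, hA⟩]
  · rintro ⟨hA, Y, hY, hpos⟩
    exact ⟨hA, hA, _, hY, hpos⟩

variable [DecidableEq V]

theorem isFractionalPackingTwo_iff (Y : Finset V → ℝ) :
    C.IsFractionalPackingTwo (fun A => Y A.1) ↔
      (∀ A ∈ C.members, 0 ≤ Y A) ∧ (∀ v, C.load Y v ≤ 1) ∧ ∑ A ∈ C.members, Y A = 2 := by
  have h1 : ∑ A : C.members, Y A.1 = ∑ A ∈ C.members, Y A := Finset.sum_coe_sort C.members Y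
  have h2 : ∀ v, C.load Y v = ∑ A : C.members, (if v ∈ A.1 then Y A.1 else 0) := fun v =>
    (Finset.sum_coe_sort C.members fun A => if v ∈ A then Y A else 0).symm
  simp only [IsFractionalPackingTwo, IsFractionalPacking, h1, h2, Subtype.forall, and_assoc]

theorem eq_zero_of_notMem_core {Y : Finset V → ℝ}
    (hY : C.IsFractionalPackingTwo (fun A => Y A.1)) {A : Finset V} (hA : A ∈ C.members)
    (hA' : A ∉ C.core.members) : Y A = 0 := by
  by_contra hne
  have h0 := ((isFractionalPackingTwo_iff Y).1 hY).1 A hA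
  exact hA' (mem_core_iff.2 ⟨hA, Y, hY, lt_of_le_of_ne h0 (Ne.symm hne)⟩)

/-- Complementary slackness: the loads of `u` and `v` add up to at most two, the value of the
packing, while each member meets `{u, v}`. So no member of positive weight contains both. -/
theorem mem_core_of_adj {u v : V} (h : C.graph.Adj u v) {A : Finset V} (hA : A ∈ C.core.members) :
    u ∈ A ↔ v ∉ A := by
  obtain ⟨hAm, Y, hY, hpos⟩ := mem_core_iff.1 hA
  obtain ⟨hnn, hload, hsum⟩ := (isFractionalPackingTwo_iff Y).1 hY
  have hor := mem_or_mem_of_adj h hAm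
  suffices ¬ (u ∈ A ∧ v ∈ A) by tauto
  rintro ⟨hu, hv⟩
  have key : ∑ B ∈ C.members,
      ((if u ∈ B then Y B else 0) + (if v ∈ B then Y B else 0) - Y B) ≤ 0 := by
    rw [Finset.sum_sub_distrib, Finset.sum_add_distrib, hsum]
    have h1 := hload u
    have h2 := hload v
    rw [load] at h1 h2
    linarith
  have hle := Finset.single_le_sum (f := fun B =>
    ((if u ∈ B then Y B else 0) + (if v ∈ B then Y B else 0) - Y B)) (fun B hB => by
      have := hnn B hB
      rcases mem_or_mem_of_adj h hB with hB | hB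
      · simp only [hB, if_true]; split_ifs <;> linarith
      · simp only [hB, if_true]; split_ifs <;> linarith) hAm
  simp only [hu, hv, if_true] at hle
  linarith

/-- Crossing an edge flips membership in both `A` and `B`, so whether they agree is constant on
components. -/
theorem mem_core_iff_of_reachable {A B : Finset V} (hA : A ∈ C.core.members)
    (hB : B ∈ C.core.members) {u v : V} (h : C.graph.Reachable u v) :
    (u ∈ A ↔ u ∈ B) ↔ (v ∈ A ↔ v ∈ B) := by
  obtain ⟨p⟩ := h
  induction p with
  | nil => rfl
  | cons h _ ih =>
    rw [← ih, mem_core_of_adj h hA, mem_core_of_adj h hB]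
    tauto

variable [Fintype V]

theorem exists_isFractionalPackingTwo (hclean : C.IsClean) (hC : C.IsTangled) :
    ∃ Y : Finset V → ℝ, C.IsFractionalPackingTwo (fun A => Y A.1) := by
  obtain ⟨Y, hY⟩ := exists_isMinorPacking hclean.isCleanCoverSystem (I := ∅) (M := Finset.univ)
    (fun h => by simpa using hC.two_le_card h) (fun u _ h => by simpa using hC.two_le_card h)
  exact ⟨Y, (isFractionalPackingTwo_iff Y).2 ⟨fun A _ => hY.nonneg A,
    fun v => hY.load_le v (Finset.mem_univ v), hY.value⟩⟩

theorem exists_mem_core (hclean : C.IsClean) (hC : C.IsTangled) : ∃ A, A ∈ C.core.members := by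
  obtain ⟨Y, hY⟩ := exists_isFractionalPackingTwo hclean hC
  obtain ⟨hnn, -, hsum⟩ := (isFractionalPackingTwo_iff Y).1 hY
  obtain ⟨A, hA, hne⟩ := Finset.exists_ne_zero_of_sum_ne_zero (hsum.trans_ne two_ne_zero)
  exact ⟨A, mem_core_iff.2 ⟨hA, Y, hY, lt_of_le_of_ne (hnn A hA) hne.symm⟩⟩

theorem exists_isSetcore (hclean : C.IsClean) (hC : C.IsTangled) :
    ∃ S : Finset (Fin C.rank → Bool), C.IsSetcore S := by
  classical
  obtain ⟨A₀, hA₀⟩ := exists_mem_core hclean hC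
  -- Coordinates are the components, and the bit records membership in the reference member `A₀`. A
  -- neighbour has the opposite bit, so both values occur. The point of a core member marks the
  -- components on which it agrees with `A₀`.
  let e : C.graph.ConnectedComponent ≃ Fin C.rank := Finite.equivFin _
  let f : V → Fin C.rank × Bool := fun v => (e (C.graph.connectedComponentMk v), decide (v ∈ A₀))
  refine ⟨Finset.univ.filter fun p =>
    Finset.univ.filter (fun v => p (f v).1 = (f v).2) ∈ C.core.members, f, ?_, ?_⟩
  · rintro ⟨i, b⟩
    obtain ⟨v, hv⟩ := (e.symm i).exists_rep
    have hv' : e (C.graph.connectedComponentMk v) = i := by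
      rw [← e.apply_symm_apply i, ← hv]; rfl
    obtain ⟨u, hu⟩ := hC.exists_adj v
    have hu' : e (C.graph.connectedComponentMk u) = i := by
      rw [← hv', ConnectedComponent.sound hu.reachable]
    have hex := mem_core_of_adj hu hA₀
    by_cases hb : decide (v ∈ A₀) = b
    · exact ⟨v, Prod.ext hv' hb⟩
    · refine ⟨u, Prod.ext hu' ?_⟩
      simp only [f]
      cases b <;> simp_all
  · intro A
    simp only [cuboid, Finset.mem_image, Finset.mem_filter, Finset.mem_univ, true_and]
    constructor
    · intro hA
      let p : Fin C.rank → Bool := fun i =>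
        decide ((e.symm i).out ∈ A ↔ (e.symm i).out ∈ A₀)
      have hp : ∀ v, p (f v).1 = (f v).2 ↔ v ∈ A := by
        intro v
        have hr : C.graph.Reachable (C.graph.connectedComponentMk v).out v :=
          ConnectedComponent.exact (Quot.out_eq _)
        have := mem_core_iff_of_reachable hA hA₀ hr
        simp only [p, f, Equiv.symm_apply_apply, this]
        by_cases h1 : v ∈ A <;> by_cases h2 : v ∈ A₀ <;> simp [h1, h2]
      refine ⟨_, ⟨p, ?_, rfl⟩, fun v => by simp [hp]⟩
      have : Finset.univ.filter (fun v => p (f v).1 = (f v).2) = A := by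
        ext v; simp [hp]
      rwa [this]
    · rintro ⟨_, ⟨p, hp, rfl⟩, hA⟩
      have : Finset.univ.filter (fun v => p (f v).1 = (f v).2) = A := by
        ext v; simp [hA]
      rwa [← this]

end Core

end Clutter

namespace Clutter

open SimpleGraph

/-! ### Packings of value two as weights on the setcore. -/

section Setcore

variable {V : Type*} [Fintype V] {n : ℕ}

/-- The member of the duplication of a cuboid given by a point `p`. -/
def pullback (f : V → Fin n × Bool) (p : Fin n → Bool) : Finset V :=
  Finset.univ.filter fun v => p (f v).1 = (f v).2

theorem mem_pullback {f : V → Fin n × Bool} {p : Fin n → Bool} {v : V} :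
    v ∈ pullback f p ↔ p (f v).1 = (f v).2 := by simp [pullback]

theorem pullback_injective {f : V → Fin n × Bool} (hf : Function.Surjective f) :
    Function.Injective (pullback f) := by
  intro p q h
  funext i
  obtain ⟨v, hv⟩ := hf (i, p i)
  have h1 : v ∈ pullback f q := by
    rw [← h, mem_pullback, hv]
  rw [mem_pullback, hv] at h1
  exact h1.symm

variable {C : Clutter V} {S : Finset (Fin n → Bool)} {f : V → Fin n × Bool}

theorem mem_core_iff_pullback
    (hcore : ∀ A : Finset V, A ∈ C.core.members ↔ ∃ B ∈ (cuboid S).members, ∀ v, v ∈ A ↔ f v ∈ B)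
    {A : Finset V} : A ∈ C.core.members ↔ ∃ p ∈ S, pullback f p = A := by
  rw [hcore]
  simp only [cuboid, Finset.mem_image]
  constructor
  · rintro ⟨_, ⟨p, hp, rfl⟩, hA⟩
    exact ⟨p, hp, by ext v; simp [mem_pullback, hA]⟩
  · rintro ⟨p, hp, rfl⟩
    exact ⟨_, ⟨p, hp, rfl⟩, fun v => by simp [mem_pullback]⟩

variable [DecidableEq V]

theorem sum_members_eq
    (hf : Function.Surjective f)
    (hcore : ∀ A : Finset V, A ∈ C.core.members ↔ ∃ p ∈ S, pullback f p = A)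
    {h : Finset V → ℝ}
    (hh : ∀ A ∈ C.members, A ∉ C.core.members → h A = 0) :
    ∑ A ∈ C.members, h A = ∑ p ∈ S, h (pullback f p) := by
  have hc : C.core.members = S.image (pullback f) := by
    ext A
    rw [hcore, Finset.mem_image]
  rw [← Finset.sum_subset (fun A hA => (mem_core_iff.1 hA).1) hh, hc,
    Finset.sum_image fun p _ q _ h => pullback_injective hf h]

theorem load_eq
    (hf : Function.Surjective f)
    (hcore : ∀ A : Finset V, A ∈ C.core.members ↔ ∃ p ∈ S, pullback f p = A)
    {Y : Finset V → ℝ} (hY : ∀ A ∈ C.members, A ∉ C.core.members → Y A = 0) (v : V) :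
    C.load Y v = ∑ p ∈ S, if p (f v).1 = (f v).2 then Y (pullback f p) else 0 := by
  rw [load, sum_members_eq hf hcore]
  · simp only [mem_pullback]
  · intro A hA hA'
    rw [hY A hA hA', ite_self]

/-- The elements over `(i, true)` and `(i, false)` split the total weight two into two loads of at
most one, so both are equal to one. -/
theorem sum_coordinate_eq_one
    (hf : Function.Surjective f)
    (hcore : ∀ A : Finset V, A ∈ C.core.members ↔ ∃ p ∈ S, pullback f p = A)
    {Y : Finset V → ℝ}
    (hY : C.IsFractionalPackingTwo (fun A => Y A.1)) (i : Fin n) :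
    ∑ p ∈ S, (if p i then Y (pullback f p) else 0) = 1 := by
  have hoff := fun A => eq_zero_of_notMem_core (A := A) hY
  obtain ⟨-, hload, hsum⟩ := (isFractionalPackingTwo_iff Y).1 hY
  rw [sum_members_eq hf hcore hoff] at hsum
  obtain ⟨u, hu⟩ := hf (i, true)
  obtain ⟨v, hv⟩ := hf (i, false)
  have h1 := hload u
  have h2 := hload v
  rw [load_eq hf hcore hoff] at h1 h2
  simp only [hu, hv] at h1 h2
  have h3 : ∑ p ∈ S, (if p i = true then Y (pullback f p) else 0) +
      ∑ p ∈ S, (if p i = false then Y (pullback f p) else 0) = 2 := by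
    rw [← hsum, ← Finset.sum_add_distrib]
    refine Finset.sum_congr rfl fun p _ => ?_
    cases p i <;> simp
  linarith

theorem eq_of_affineIndependent
    (hf : Function.Surjective f)
    (hcore : ∀ A : Finset V, A ∈ C.core.members ↔ ∃ p ∈ S, pullback f p = A)
    {Y Z : Finset V → ℝ}
    (hS : AffineIndependent ℝ (fun p : S => zeroOnePoint p.1))
    (hY : C.IsFractionalPackingTwo (fun A => Y A.1))
    (hZ : C.IsFractionalPackingTwo (fun A => Z A.1)) {A : Finset V} (hA : A ∈ C.members) :
    Y A = Z A := by
  by_cases hA' : A ∈ C.core.members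
  · obtain ⟨p, hp, rfl⟩ := (hcore A).1 hA'
    have h := affineIndependent_zeroOnePoint_iff.1 hS
      (fun p => Y (pullback f p) - Z (pullback f p)) ?_ ?_ p hp
    · exact sub_eq_zero.1 h
    · rw [Finset.sum_sub_distrib,
        ← sum_members_eq hf hcore (fun A => eq_zero_of_notMem_core (A := A) hY),
        ← sum_members_eq hf hcore (fun A => eq_zero_of_notMem_core (A := A) hZ),
        ((isFractionalPackingTwo_iff Y).1 hY).2.2, ((isFractionalPackingTwo_iff Z).1 hZ).2.2,
        sub_self]
    · intro i
      rw [← sub_self (1 : ℝ)]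
      refine Eq.trans ?_ (congrArg₂ (· - ·) (sum_coordinate_eq_one hf hcore hY i)
        (sum_coordinate_eq_one hf hcore hZ i))
      rw [← Finset.sum_sub_distrib]
      refine Finset.sum_congr rfl fun p _ => ?_
      split_ifs <;> simp
  · rw [eq_zero_of_notMem_core hY hA hA', eq_zero_of_notMem_core hZ hA hA']

/-- By uniqueness `Y` is positive on every core member. An affine dependency `μ` changes neither
loads nor value, so `Y` plus a small positive multiple of `μ` is again a packing of value two, and
uniqueness forces `μ = 0`. -/
theorem affineIndependent_of_unique
    (hf : Function.Surjective f)
    (hcore : ∀ A : Finset V, A ∈ C.core.members ↔ ∃ p ∈ S, pullback f p = A)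
    {Y : Finset V → ℝ}
    (hY : C.IsFractionalPackingTwo (fun A => Y A.1))
    (huniq : ∀ Z : Finset V → ℝ, C.IsFractionalPackingTwo (fun A => Z A.1) →
      ∀ A ∈ C.members, Z A = Y A) :
    AffineIndependent ℝ (fun p : S => zeroOnePoint p.1) := by
  classical
  have hmem : ∀ p ∈ S, pullback f p ∈ C.core.members := fun p hp => (hcore _).2 ⟨p, hp, rfl⟩
  have hpos : ∀ p ∈ S, 0 < Y (pullback f p) := by
    intro p hp
    obtain ⟨hA, Z, hZ, hpos⟩ := mem_core_iff.1 (hmem p hp)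
    rwa [← huniq Z hZ _ hA]
  rw [affineIndependent_zeroOnePoint_iff]
  intro μ h0 h1 q hq
  obtain ⟨t, ht, htpos⟩ : ∃ t : ℝ, (∀ p ∈ S, 0 < Y (pullback f p) + t * μ p) ∧ 0 < t := by
    have hev : ∀ p ∈ S, ∀ᶠ t in nhdsWithin (0 : ℝ) (Set.Ioi 0),
        0 < Y (pullback f p) + t * μ p := by
      intro p hp
      have hc : Filter.Tendsto (fun t : ℝ => Y (pullback f p) + t * μ p)
          (nhdsWithin 0 (Set.Ioi 0)) (nhds (Y (pullback f p) + 0 * μ p)) :=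
        (Continuous.tendsto (by fun_prop) 0).mono_left nhdsWithin_le_nhds
      refine hc.eventually_const_lt ?_
      simpa using hpos p hp
    exact (((Filter.eventually_all_finset S).2 hev).and self_mem_nhdsWithin).exists
  let Z : Finset V → ℝ := fun A => Y A + t * ∑ p ∈ S, if pullback f p = A then μ p else 0
  have hZS : ∀ p ∈ S, Z (pullback f p) = Y (pullback f p) + t * μ p := by
    intro p hp
    simp [Z, (pullback_injective hf).eq_iff, hp]
  have hZoff : ∀ A, A ∉ C.core.members → Z A = Y A := by
    intro A hA
    have : ∑ p ∈ S, (if pullback f p = A then μ p else 0) = 0 := by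
      refine Finset.sum_eq_zero fun p hp => if_neg ?_
      rintro rfl
      exact hA (hmem p hp)
    simp [Z, this]
  have hYoff : ∀ A ∈ C.members, A ∉ C.core.members → Y A = 0 := fun A =>
    eq_zero_of_notMem_core hY
  have hZoff' : ∀ A ∈ C.members, A ∉ C.core.members → Z A = 0 := fun A hA hA' =>
    (hZoff A hA').trans (hYoff A hA hA')
  obtain ⟨hnn, hload, hsum⟩ := (isFractionalPackingTwo_iff Y).1 hY
  have hside : ∀ i b, ∑ p ∈ S, (if p i = b then μ p else 0) = 0 := by
    intro i b
    cases b
    · have h2 := h1 i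
      have h3 : ∑ p ∈ S, (if p i = false then μ p else 0) +
          ∑ p ∈ S, (if p i = true then μ p else 0) = ∑ p ∈ S, μ p := by
        rw [← Finset.sum_add_distrib]
        refine Finset.sum_congr rfl fun p _ => ?_
        cases p i <;> simp
      linarith
    · exact h1 i
  have hZ : C.IsFractionalPackingTwo (fun A => Z A.1) := by
    refine (isFractionalPackingTwo_iff Z).2 ⟨fun A hA => ?_, fun v => ?_, ?_⟩
    · by_cases hA' : A ∈ C.core.members
      · obtain ⟨p, hp, rfl⟩ := (hcore A).1 hA'
        rw [hZS p hp]
        exact (ht p hp).le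
      · rw [hZoff' A hA hA']
    · have hv := hload v
      rw [load_eq hf hcore hYoff] at hv
      rw [load_eq hf hcore hZoff']
      have : ∀ p ∈ S, (if p (f v).1 = (f v).2 then Z (pullback f p) else 0) =
          (if p (f v).1 = (f v).2 then Y (pullback f p) else 0) +
            t * (if p (f v).1 = (f v).2 then μ p else 0) := by
        intro p hp
        rw [hZS p hp]
        split_ifs <;> simp
      rw [Finset.sum_congr rfl this, Finset.sum_add_distrib, ← Finset.mul_sum, hside, mul_zero,
        add_zero]
      exact hv
    · rw [sum_members_eq hf hcore hZoff', Finset.sum_congr rfl hZS, Finset.sum_add_distrib,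
        ← Finset.mul_sum, h0, mul_zero, add_zero, ← sum_members_eq hf hcore hYoff, hsum]
  have := huniq Z hZ _ (mem_core_iff.1 (hmem q hq)).1
  rw [hZS q hq, add_eq_left] at this
  exact (mul_eq_zero.1 this).resolve_left htpos.ne'

end Setcore

end Clutter

theorem mainTheorem7 {V : Type*} [Fintype V] (C : Clutter V)
    (hclean : C.IsClean) (htangled : C.IsTangled) :
    (∃ S : Finset (Fin C.rank → Bool), C.IsSetcore S) ∧
    ∀ S : Finset (Fin C.rank → Bool), C.IsSetcore S →
      (IsSimplexSet (convOfPoints S) ↔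
        ∃! y : C.members → ℝ, C.IsFractionalPackingTwo y) := by
  classical
  refine ⟨Clutter.exists_isSetcore hclean htangled, ?_⟩
  rintro S ⟨f, hf, hS⟩
  have hcore : ∀ A : Finset V, A ∈ C.core.members ↔ ∃ p ∈ S, Clutter.pullback f p = A :=
    fun A => Clutter.mem_core_iff_pullback hS
  obtain ⟨A, hA⟩ := Clutter.exists_mem_core hclean htangled
  obtain ⟨p, hp, -⟩ := (hcore A).1 hA
  rw [isSimplexSet_convOfPoints_iff ⟨p, hp⟩]
  constructor
  · intro hind
    obtain ⟨Y, hY⟩ := Clutter.exists_isFractionalPackingTwo hclean htangled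
    refine ⟨_, hY, fun z hz => ?_⟩
    rw [Clutter.eq_extendWeight z] at hz ⊢
    exact funext fun A => Clutter.eq_of_affineIndependent hf hcore hind hz hY A.2
  · rintro ⟨y, hy, huniq⟩
    rw [Clutter.eq_extendWeight y] at hy
    refine Clutter.affineIndependent_of_unique hf hcore hy fun Z hZ A hA => ?_
    rw [Clutter.extendWeight_coe y ⟨A, hA⟩]
    exact congrFun (huniq _ hZ) ⟨A, hA⟩
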